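/- Let $p\ge 2$ and let $(g_{i_1\ldots i_p})_{1\le i_1<\cdots<i_p<\infty}$ be independent standard Gaussian random variables on a probability space $(\Omega,\mu)$. Extend $g$ symmetrically to tuples with distinct entries. For $N\ge 1$ define the interaction tensor of the $p$-spin Sherrington–Kirkpatrick model by $$J_{i_1\ldots i_p}=N^{\frac{1-p}{2}}\,g_{i_1\ldots i_p}\quad\text{if } i_1,\ldots,i_p\in\{1,\ldots,N\}\text{ are distinct},\qquad J_{i_1\ldots i_p}=0\text{ otherwise}.$$ For $x\in\{-1,1\}^N$ put $$H_N(x)=\sum_{1\le i_1,\ldots,i_p\le N}J_{i_1\ldots i_p}x_{i_1}\cdots x_{i_p},\qquad m_i(x)=\sum_{1\le i_2,\ldots,i_p\le N}J_{i\,i_2\ldots i_p}x_{i_2}\cdots x_{i_p}.$$ For $\beta>0$, given the disorder, let $\mathbb P_\beta$ be the probability measure on $\{-1,1\}^N$ with mass proportional to $e^{\beta H_N(x)}$. The maximum pseudo-likelihood (MPL) estimate of $\beta$ from a single sample $X\sim\mathbb P_\beta$ is $$\hat\beta_N(X)=\inf\Big\{b\ge 0:\ H_N(X)=\sum_{i=1}^N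 m_i(X)\tanh\big(p\,b\,m_i(X)\big)\Big\}\in[0,+\infty],\qquad \inf\emptyset=+\infty.$$ Then, for almost every realization of the disorder $g$, the MPL estimate is $\sqrt N$-consistent for every $\beta>0$. More precisely, there are deterministic constants $M(\delta,\beta)>0$ (for $\delta,\beta>0$), not depending on the realization of the disorder, such that for $\mu$-almost every realization the following holds simultaneously for all $\beta>0$ and all $\delta>0$: $$\mathbb P_\beta\big(\sqrt N\,|\hat\beta_N(X)-\beta|\le M(\delta,\beta)\big)>1-\delta\qquad\text{for all sufficiently large } N.$$ -/

import Mathlib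

open MeasureTheory ProbabilityTheory Filter

namespace TensorIsing

/-- Spin configurations: elements of `{-1, 1}^N` (the units of `ℤ` are exactly `1` and `-1`). -/
abbrev Config (N : ℕ) : Type := Fin N → ℤˣ

/-- The spin `X_i` as a real number. -/
def spin {N : ℕ} (x : Config N) (i : Fin N) : ℝ := ((x i : ℤ) : ℝ)

/-- `p`-tensors `J = (J_{i_1 … i_p})` with indices in `{1, …, N}`. -/
abbrev Tensor (p N : ℕ) : Type := (Fin p → Fin N) → ℝ

/-- The Hamiltonian `H_N(x) = ∑_{i_1, …, i_p} J_{i_1 … i_p} x_{i_1} ⋯ x_{i_p}`. -/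
noncomputable def hamiltonian {p N : ℕ} (J : Tensor p N) (x : Config N) : ℝ :=
  ∑ k : Fin p → Fin N, J k * ∏ s : Fin p, spin x (k s)

/-- The partition function `Z_N(β) = 2^{-N} ∑_x exp (β H_N(x))`. -/
noncomputable def partitionFunction {p N : ℕ} (J : Tensor p N) (β : ℝ) : ℝ :=
  (1 / 2 ^ N) * ∑ x : Config N, Real.exp (β * hamiltonian J x)

/-- The probability mass function `P_β(x) = exp (β H_N(x)) / (2^N Z_N(β))`. -/
noncomputable def isingMass {p N : ℕ} (J : Tensor p N) (β : ℝ) (x : Config N) : ℝ :=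
  1 / (2 ^ N * partitionFunction J β) * Real.exp (β * hamiltonian J x)

open Classical in
/-- The probability `P_β(X ∈ A)` of an event `A` when `X` has mass function `P_β`. -/
noncomputable def isingProb {p N : ℕ} (J : Tensor p N) (β : ℝ) (A : Set (Config N)) : ℝ :=
  ∑ x : Config N with x ∈ A, isingMass J β x

/-- The local magnetization `m_i(x) = ∑_{i_2, …, i_p} J_{i i_2 … i_p} x_{i_2} ⋯ x_{i_p}`:
the sum over all index tuples whose first entry is `i`, the product over all later entries. -/
noncomputable def localField {p N : ℕ} (J : Tensor p N) (x : Config N) (i : Fin N) : ℝ :=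
  ∑ k : Fin p → Fin N with ∀ s : Fin p, (s : ℕ) = 0 → k s = i,
    J k * ∏ s ∈ Finset.univ.filter (fun s : Fin p => (s : ℕ) ≠ 0), spin x (k s)

/-- The maximum pseudo-likelihood estimate
`inf {b ≥ 0 : H_N(x) = ∑_i m_i(x) tanh (p b m_i(x))}`, an extended real number:
the infimum of the empty set is `+∞`. -/
noncomputable def mple {p N : ℕ} (J : Tensor p N) (x : Config N) : EReal :=
  sInf ((fun b : ℝ => (b : EReal)) '' {b : ℝ | 0 ≤ b ∧
    hamiltonian J x =
      ∑ i : Fin N, localField J x i * Real.tanh ((p : ℝ) * b * localField J x i)})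

/-- The event `√N |β̂_N(X) - β| ≤ M`; in particular the estimate is finite on it. -/
def mpleWithin {p N : ℕ} (J : Tensor p N) (β M : ℝ) : Set (Config N) :=
  {x | ∃ b : ℝ, mple J x = (b : EReal) ∧ Real.sqrt (N : ℝ) * |b - β| ≤ M}

/-- Index set of the disorder: `p`-element sets `{i_1 < … < i_p}` of natural numbers. -/
abbrev CouplingIndex (p : ℕ) : Type := {S : Finset ℕ // S.card = p}

/-- The set `{i_1, …, i_p}` of the entries of a tuple with distinct entries. -/
def tupleIndex {p N : ℕ} (k : Fin p → Fin N) (hk : Function.Injective k) : CouplingIndex p :=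
  ⟨Finset.univ.image (fun s : Fin p => (k s : ℕ)),
    (Finset.card_image_of_injective _ (Fin.val_injective.comp hk)).trans (Finset.card_fin p)⟩

open Classical in
/-- The interaction tensor of the `p`-spin Sherrington-Kirkpatrick model,
`J_{i_1 … i_p} = N^{(1-p)/2} g_{i_1 … i_p}`, with `g` extended symmetrically from increasing
tuples to tuples with distinct entries, and zero on tuples with a repeated entry. -/
noncomputable def skTensor {p : ℕ} (g : CouplingIndex p → ℝ) (N : ℕ) : Tensor p N :=
  fun k => if hk : Function.Injective k then
    (N : ℝ) ^ ((1 - (p : ℝ)) / 2) * g (tupleIndex k hk) else 0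

end TensorIsing

/-! Write the model with one coupling per `p`-set of sites. The equation defining the estimate
becomes `score a (p * b) x = 0`, where the score is the sum over sites of the residuals `m_i (x_i -
tanh (θ m_i))` and `θ = p b`. Two facts give the rate: at the true parameter the score has second
moment `O(N)`, and as a function of `θ` it decreases with slope at least `c N` on bounded intervals.
Chebyshev makes the score `O(√N)` with probability above `1 - δ`, so its unique zero lies within
`O(1/√N)` of the truth (`mem_mpleWithin`, `one_sub_lt_isingProb_mpleWithin`).

Second moment: given the other spins, `x_i` has mean `tanh (p β m_i)`, so each residual is
conditionally centered. Pairing `x` with its flip at `i` turns the second moment into half the mean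
of `∑ i, residual_i * (score x - score (flip i x))` (`sum_isingMass_score_sq_le`). A Taylor
expansion in the discrete derivatives of the fields bounds this sum by `O(N)` for every `x`
(`sum_residual_mul_diff_le`). Slope: at least half of the sites have bounded field, and their
squared fields still add up to order `N` (`score_sub_ge`).

Both facts are deterministic once the couplings satisfy `RegularCouplings`, which involves neither
`β` nor `δ`. Each of its conditions is a family of at most `4 ^ N` inequalities, each failing with
Gaussian probability at most `8 ^ (-N)`; a union bound and Borel–Cantelli give regularity for all
large `N`, almost surely (`ae_eventually_regularCouplings`). -/

namespace TensorIsing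

/-! ### Tails of Gaussian quadratic forms -/

section Gaussian

/-- The standard Gaussian measure on `ℝ^κ`. -/
noncomputable abbrev stdGaussianPi (κ : Type*) [Fintype κ] : Measure (κ → ℝ) :=
  Measure.pi fun _ : κ => gaussianReal 0 1

variable {ι κ : Type*} [Fintype ι] [Fintype κ]

/-- Read from right to left, this linearizes the exponential of a sum of squares by introducing an
auxiliary Gaussian vector. -/
lemma lintegral_exp_linear (c : κ → ℝ) :
    ∫⁻ y, ENNReal.ofReal (Real.exp (∑ k, c k * y k)) ∂stdGaussianPi κ
      = ENNReal.ofReal (Real.exp ((∑ k, c k ^ 2) / 2)) := by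
  have hexp : (fun y : κ → ℝ => Real.exp (∑ k, c k * y k))
      = fun y => ∏ k, Real.exp (c k * y k) := by
    funext y; exact Real.exp_sum _ _
  rw [← ofReal_integral_eq_lintegral_ofReal]
  · congr 1
    rw [hexp, integral_fintype_prod_eq_prod (fun k (x : ℝ) => Real.exp (c k * x)),
      Finset.sum_div, Real.exp_sum]
    refine Finset.prod_congr rfl fun k _ => ?_
    have := congrFun (mgf_fun_id_gaussianReal (μ := 0) (v := 1)) (c k)
    simp only [mgf] at this
    rw [this]
    simp
  · rw [hexp]
    exact Integrable.fintype_prod fun k => integrable_exp_mul_gaussianReal (c k)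
  · exact Eventually.of_forall fun y => (Real.exp_pos _).le

lemma integral_cexp_linear (c : κ → ℝ) :
    ∫ y, Complex.exp ((∑ k, c k * y k : ℝ) * Complex.I) ∂stdGaussianPi κ
      = (Real.exp (-(∑ k, c k ^ 2) / 2) : ℝ) := by
  have hexp : (fun y : κ → ℝ => Complex.exp ((∑ k, c k * y k : ℝ) * Complex.I))
      = fun y => ∏ k, Complex.exp ((c k) * (y k) * Complex.I) := by
    funext y
    rw [← Complex.exp_sum]
    push_cast
    rw [Finset.sum_mul]
  rw [hexp, integral_fintype_prod_eq_prod
    (fun k (x : ℝ) => Complex.exp ((c k) * x * Complex.I)), neg_div, Finset.sum_div,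
    ← Finset.sum_neg_distrib, Real.exp_sum]
  push_cast
  refine Finset.prod_congr rfl fun k _ => ?_
  have := charFun_gaussianReal (μ := 0) (v := 1) (c k)
  rw [charFun_apply_real] at this
  rw [this]
  simp

lemma integral_exp_sq_gaussianReal {a : ℝ} (ha : a < 1) :
    ∫ x, Real.exp (a * x ^ 2 / 2) ∂gaussianReal 0 1 = (√(1 - a))⁻¹ := by
  rw [integral_gaussianReal_eq_integral_smul one_ne_zero]
  have h : ∀ x : ℝ, gaussianPDFReal 0 1 x • Real.exp (a * x ^ 2 / 2)
      = (√(2 * Real.pi))⁻¹ * Real.exp (-((1 - a) / 2) * x ^ 2) := by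
    intro x
    simp only [gaussianPDFReal_def, smul_eq_mul, NNReal.coe_one, mul_one, sub_zero]
    rw [mul_assoc, ← Real.exp_add]
    congr 2
    ring
  simp_rw [h]
  rw [integral_const_mul, integral_gaussian, ← Real.sqrt_inv, ← Real.sqrt_mul (by positivity),
    ← Real.sqrt_inv]
  congr 1
  have : 1 - a ≠ 0 := by linarith
  field_simp

/-- A non-integrable function has Bochner integral `0`, whereas the computed value is positive. -/
lemma integrable_exp_sq_gaussianReal {a : ℝ} (ha : a < 1) :
    Integrable (fun x => Real.exp (a * x ^ 2 / 2)) (gaussianReal 0 1) := by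
  by_contra h
  have h1 := integral_exp_sq_gaussianReal ha
  rw [integral_undef h] at h1
  have : 0 < (√(1 - a))⁻¹ := inv_pos.mpr (Real.sqrt_pos.mpr (by linarith))
  linarith

lemma integral_exp_sum_sq {a : ℝ} :
    ∫ y, Real.exp (a * (∑ k, y k ^ 2) / 2) ∂stdGaussianPi κ
      = (∫ x, Real.exp (a * x ^ 2 / 2) ∂gaussianReal 0 1) ^ Fintype.card κ := by
  have hexp : (fun y : κ → ℝ => Real.exp (a * (∑ k, y k ^ 2) / 2))
      = fun y => ∏ k, Real.exp (a * y k ^ 2 / 2) := by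
    funext y; rw [← Real.exp_sum, Finset.mul_sum, Finset.sum_div]
  rw [hexp, integral_fintype_prod_eq_prod (fun k (x : ℝ) => Real.exp (a * x ^ 2 / 2)),
    Finset.prod_const, Finset.card_univ]

lemma integrable_exp_sum_sq {a : ℝ} (ha : a < 1) :
    Integrable (fun y : κ → ℝ => Real.exp (a * (∑ k, y k ^ 2) / 2)) (stdGaussianPi κ) := by
  have hexp : (fun y : κ → ℝ => Real.exp (a * (∑ k, y k ^ 2) / 2))
      = fun y => ∏ k, Real.exp (a * y k ^ 2 / 2) := by
    funext y; rw [← Real.exp_sum, Finset.mul_sum, Finset.sum_div]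
  rw [hexp]
  exact Integrable.fintype_prod fun k => integrable_exp_sq_gaussianReal ha

/-- The exponent of the two linearization identities, read as a form in either variable. -/
lemma bilinear_swap (A : ι → κ → ℝ) (s : ℝ) (u : ι → ℝ) (y : κ → ℝ) :
    ∑ i, (s * ∑ k, A i k * y k) * u i = ∑ k, (s * ∑ i, u i * A i k) * y k := by
  simp_rw [Finset.mul_sum, Finset.sum_mul]
  rw [Finset.sum_comm]
  refine Finset.sum_congr rfl fun k _ => Finset.sum_congr rfl fun i _ => by ring

/-- Exponential moment of the squared norm of a Gaussian vector with covariance at most `τ`. -/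
lemma lintegral_exp_quadratic_le (A : ι → κ → ℝ) {τ : ℝ} (hτ : 0 < τ)
    (hA : ∀ u : ι → ℝ, ∑ k, (∑ i, u i * A i k) ^ 2 ≤ τ * ∑ i, u i ^ 2) :
    ∫⁻ y, ENNReal.ofReal (Real.exp ((∑ i, (∑ k, A i k * y k) ^ 2) / (4 * τ))) ∂stdGaussianPi κ
      ≤ 2 ^ Fintype.card ι := by
  -- Chosen so that `s ^ 2 / 2 = 1 / (4 * τ)`. After the swap of integrals the exponent is at most
  -- `∑ i, u i ^ 2 / 4`, below the integrability threshold.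
  set s : ℝ := √(1 / (2 * τ)) with hs
  have hs2 : s ^ 2 = 1 / (2 * τ) := Real.sq_sqrt (by positivity)
  calc ∫⁻ y, ENNReal.ofReal (Real.exp ((∑ i, (∑ k, A i k * y k) ^ 2) / (4 * τ))) ∂stdGaussianPi κ
      = ∫⁻ y, ∫⁻ u, ENNReal.ofReal (Real.exp (∑ i, (s * ∑ k, A i k * y k) * u i))
          ∂stdGaussianPi ι ∂stdGaussianPi κ := by
        refine lintegral_congr fun y => ?_
        rw [lintegral_exp_linear]
        congr 2
        simp_rw [mul_pow, ← Finset.mul_sum, hs2]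
        field_simp
        norm_num
    _ = ∫⁻ u, ∫⁻ y, ENNReal.ofReal (Real.exp (∑ i, (s * ∑ k, A i k * y k) * u i))
          ∂stdGaussianPi κ ∂stdGaussianPi ι := by
        refine lintegral_lintegral_swap (Measurable.aemeasurable ?_)
        simp only [Function.uncurry_def]
        fun_prop
    _ = ∫⁻ u, ENNReal.ofReal (Real.exp ((∑ k, (s * ∑ i, u i * A i k) ^ 2) / 2))
          ∂stdGaussianPi ι := by
        refine lintegral_congr fun u => ?_
        simp_rw [bilinear_swap]
        rw [lintegral_exp_linear]
    _ ≤ ∫⁻ u, ENNReal.ofReal (Real.exp ((1 / 2) * (∑ i, u i ^ 2) / 2)) ∂stdGaussianPi ι := by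
        refine lintegral_mono fun u => ENNReal.ofReal_le_ofReal (Real.exp_le_exp.mpr ?_)
        simp_rw [mul_pow, ← Finset.mul_sum, hs2]
        have := mul_le_mul_of_nonneg_left (hA u) (by positivity : 0 ≤ 1 / (2 * τ))
        have h2 : 1 / (2 * τ) * (τ * ∑ i, u i ^ 2) = 1 / 2 * ∑ i, u i ^ 2 := by field_simp
        linarith
    _ = ENNReal.ofReal ((√(1 - 1 / 2))⁻¹ ^ Fintype.card ι) := by
        rw [← ofReal_integral_eq_lintegral_ofReal (integrable_exp_sum_sq (by norm_num))
          (Eventually.of_forall fun y => (Real.exp_pos _).le), integral_exp_sum_sq,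
          integral_exp_sq_gaussianReal (by norm_num)]
    _ ≤ 2 ^ Fintype.card ι := by
        rw [ENNReal.ofReal_pow (by positivity)]
        gcongr
        rw [ENNReal.ofReal_le_ofNat]
        have : (1 / 2 : ℝ) ≤ √(1 - 1 / 2) := Real.le_sqrt_of_sq_le (by norm_num)
        calc (√(1 - 1 / 2))⁻¹ ≤ (1 / 2 : ℝ)⁻¹ := inv_anti₀ (by norm_num) this
          _ = _ := by norm_num

/-- Laplace transform of the squared norm of a Gaussian vector with covariance at least `τ`. -/
lemma integral_exp_neg_quadratic_le (A : ι → κ → ℝ) {τ l : ℝ} (hτ : 0 < τ) (hl : 0 < l)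
    (hA : ∀ u : ι → ℝ, τ * ∑ i, u i ^ 2 ≤ ∑ k, (∑ i, u i * A i k) ^ 2) :
    ∫ y, Real.exp (-(l * ∑ i, (∑ k, A i k * y k) ^ 2) / 2) ∂stdGaussianPi κ
      ≤ (√(1 + l * τ))⁻¹ ^ Fintype.card ι := by
  set s : ℝ := √l with hs
  have hs2 : s ^ 2 = l := Real.sq_sqrt hl.le
  -- The negative exponent is linearized by the characteristic function; Fubini then exchanges the
  -- form for its transpose, to which the lower bound `hA` applies.
  have key : ∫ y, Real.exp (-(l * ∑ i, (∑ k, A i k * y k) ^ 2) / 2) ∂stdGaussianPi κ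
      = ∫ u, Real.exp (-(∑ k, (s * ∑ i, u i * A i k) ^ 2) / 2) ∂stdGaussianPi ι := by
    apply Complex.ofReal_injective
    rw [← integral_complex_ofReal, ← integral_complex_ofReal]
    calc ∫ y, ((Real.exp (-(l * ∑ i, (∑ k, A i k * y k) ^ 2) / 2) : ℝ) : ℂ) ∂stdGaussianPi κ
        = ∫ y, ∫ u, Complex.exp ((∑ i, (s * ∑ k, A i k * y k) * u i : ℝ) * Complex.I)
          ∂stdGaussianPi ι ∂stdGaussianPi κ := by
          refine integral_congr_ae (Eventually.of_forall fun y => ?_)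
          simp only
          rw [integral_cexp_linear]
          simp_rw [mul_pow, ← Finset.mul_sum, hs2]
      _ = ∫ u, ∫ y, Complex.exp ((∑ i, (s * ∑ k, A i k * y k) * u i : ℝ) * Complex.I)
          ∂stdGaussianPi κ ∂stdGaussianPi ι := by
          refine integral_integral_swap ?_
          refine Integrable.of_bound (C := 1) (Measurable.aestronglyMeasurable ?_)
            (Eventually.of_forall fun z => ?_)
          · simp only [Function.uncurry_def]
            fun_prop
          · simp only [Function.uncurry_def]
            rw [Complex.norm_exp_ofReal_mul_I]
      _ = _ := by
          refine integral_congr_ae (Eventually.of_forall fun u => ?_)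
          simp only
          simp_rw [bilinear_swap]
          rw [integral_cexp_linear]
  rw [key]
  calc ∫ u, Real.exp (-(∑ k, (s * ∑ i, u i * A i k) ^ 2) / 2) ∂stdGaussianPi ι
      ≤ ∫ u, Real.exp (-(l * τ) * (∑ i, u i ^ 2) / 2) ∂stdGaussianPi ι := by
        refine integral_mono_of_nonneg (Eventually.of_forall fun u => (Real.exp_pos _).le)
          (integrable_exp_sum_sq (by nlinarith [mul_pos hl hτ]))
          (Eventually.of_forall fun u => Real.exp_le_exp.mpr ?_)
        simp_rw [mul_pow, ← Finset.mul_sum, hs2]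
        have := mul_le_mul_of_nonneg_left (hA u) hl.le
        linarith
    _ = _ := by
        rw [integral_exp_sum_sq, integral_exp_sq_gaussianReal (by nlinarith [mul_pos hl hτ]),
          sub_neg_eq_add]

/-- Upper tail of the squared norm of a Gaussian vector. -/
lemma stdGaussianPi_quadratic_ge (A : ι → κ → ℝ) {τ : ℝ} (hτ : 0 < τ)
    (hA : ∀ u : ι → ℝ, ∑ k, (∑ i, u i * A i k) ^ 2 ≤ τ * ∑ i, u i ^ 2) (r : ℝ) :
    stdGaussianPi κ {y | 4 * τ * r < ∑ i, (∑ k, A i k * y k) ^ 2}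
      ≤ ENNReal.ofReal (Real.exp (-r)) * 2 ^ Fintype.card ι := by
  have hm : Measurable fun y : κ → ℝ =>
      ENNReal.ofReal (Real.exp ((∑ i, (∑ k, A i k * y k) ^ 2) / (4 * τ))) := by fun_prop
  have h1 := mul_meas_ge_le_lintegral₀ (μ := stdGaussianPi κ) hm.aemeasurable
    (ENNReal.ofReal (Real.exp r))
  have h2 := h1.trans (lintegral_exp_quadratic_le A hτ hA)
  have h3 : ENNReal.ofReal (Real.exp (-r)) * ENNReal.ofReal (Real.exp r) = 1 := by
    rw [← ENNReal.ofReal_mul (Real.exp_pos _).le, ← Real.exp_add]; simp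
  calc _ ≤ stdGaussianPi κ {y | ENNReal.ofReal (Real.exp r)
        ≤ ENNReal.ofReal (Real.exp ((∑ i, (∑ k, A i k * y k) ^ 2) / (4 * τ)))} := by
        refine measure_mono fun y hy => ENNReal.ofReal_le_ofReal (Real.exp_le_exp.mpr ?_)
        rw [le_div_iff₀ (by positivity)]
        have : 4 * τ * r < ∑ i, (∑ k, A i k * y k) ^ 2 := hy
        linarith
    _ = ENNReal.ofReal (Real.exp (-r)) * (ENNReal.ofReal (Real.exp r) *
          stdGaussianPi κ {y | ENNReal.ofReal (Real.exp r)
        ≤ ENNReal.ofReal (Real.exp ((∑ i, (∑ k, A i k * y k) ^ 2) / (4 * τ)))}) := by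
        rw [← mul_assoc, h3, one_mul]
    _ ≤ _ := by gcongr

/-- Lower tail of the squared norm of a Gaussian vector. -/
lemma stdGaussianPi_quadratic_le (A : ι → κ → ℝ) {τ l : ℝ} (hτ : 0 < τ) (hl : 0 < l)
    (hA : ∀ u : ι → ℝ, τ * ∑ i, u i ^ 2 ≤ ∑ k, (∑ i, u i * A i k) ^ 2) (r : ℝ) :
    stdGaussianPi κ {y | ∑ i, (∑ k, A i k * y k) ^ 2 < r}
      ≤ ENNReal.ofReal (Real.exp (l * r / 2) * (√(1 + l * τ))⁻¹ ^ Fintype.card ι) := by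
  have hint : Integrable (fun y : κ → ℝ =>
      Real.exp (-(l * ∑ i, (∑ k, A i k * y k) ^ 2) / 2)) (stdGaussianPi κ) := by
    refine Integrable.of_bound (C := 1) (Measurable.aestronglyMeasurable (by fun_prop))
      (Eventually.of_forall fun y => ?_)
    rw [Real.norm_eq_abs, abs_of_pos (Real.exp_pos _), Real.exp_le_one_iff]
    have : 0 ≤ l * ∑ i, (∑ k, A i k * y k) ^ 2 := by positivity
    linarith
  have h1 := mul_meas_ge_le_integral_of_nonneg
    (Eventually.of_forall fun y => (Real.exp_pos _).le) hint (Real.exp (-(l * r / 2)))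
  have h2 := h1.trans (integral_exp_neg_quadratic_le A hτ hl hA)
  have h3 : Real.exp (l * r / 2) * Real.exp (-(l * r / 2)) = 1 := by
    rw [← Real.exp_add]; simp
  rw [← ofReal_measureReal]
  refine ENNReal.ofReal_le_ofReal ?_
  calc _ ≤ (stdGaussianPi κ).real {y | Real.exp (-(l * r / 2))
        ≤ Real.exp (-(l * ∑ i, (∑ k, A i k * y k) ^ 2) / 2)} := by
        refine measureReal_mono fun y hy => Real.exp_le_exp.mpr ?_
        have : ∑ i, (∑ k, A i k * y k) ^ 2 < r := hy
        nlinarith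
    _ = Real.exp (l * r / 2) * (Real.exp (-(l * r / 2)) *
        (stdGaussianPi κ).real {y | Real.exp (-(l * r / 2))
        ≤ Real.exp (-(l * ∑ i, (∑ k, A i k * y k) ^ 2) / 2)}) := by
        rw [← mul_assoc, h3, one_mul]
    _ ≤ _ := by gcongr

end Gaussian

/-! ### Products of spins -/

section Spins

variable {N : ℕ}

lemma spin_mul_self (x : Config N) (i : Fin N) : spin x i * spin x i = 1 := by
  rcases Int.units_eq_one_or (x i) with h | h <;> simp [spin, h]

lemma abs_spin (x : Config N) (i : Fin N) : |spin x i| = 1 := by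
  rcases Int.units_eq_one_or (x i) with h | h <;> simp [spin, h]

/-- The product of the spins in `S`. -/
noncomputable def spinProd (x : Config N) (S : Finset (Fin N)) : ℝ := ∏ j ∈ S, spin x j

lemma abs_spinProd (x : Config N) (S : Finset (Fin N)) : |spinProd x S| = 1 := by
  simp [spinProd, Finset.abs_prod, abs_spin]

lemma spinProd_sq (x : Config N) (S : Finset (Fin N)) : spinProd x S ^ 2 = 1 := by
  rw [← sq_abs, abs_spinProd, one_pow]

lemma spin_mul_spinProd_erase (x : Config N) {S : Finset (Fin N)} {i : Fin N} (hi : i ∈ S) :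
    spin x i * spinProd x (S.erase i) = spinProd x S :=
  Finset.mul_prod_erase _ _ hi

lemma spinProd_erase (x : Config N) {S : Finset (Fin N)} {i : Fin N} (hi : i ∈ S) :
    spinProd x (S.erase i) = spinProd x S * spin x i := by
  rw [← spin_mul_spinProd_erase x hi, mul_right_comm, spin_mul_self, one_mul]

end Spins

/-- The `p`-element sets of sites. -/
abbrev SiteSet (p N : ℕ) : Type := {T : Finset (Fin N) // T.card = p}

/-! ### Couplings on site sets and variance bounds -/

section Reduced

variable {p N : ℕ}

/-- The local field of the Hamiltonian with coupling `a T` on the site set `T`. -/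
noncomputable def setField (a : SiteSet p N → ℝ) (x : Config N) (i : Fin N) : ℝ :=
  ∑ T : SiteSet p N, (if i ∈ T.1 then spinProd x (T.1.erase i) else 0) * a T

/-- The discrete derivative of the local field at `j` in the direction `i`. -/
noncomputable def setHess (a : SiteSet p N → ℝ) (x : Config N) (i j : Fin N) : ℝ :=
  ∑ T : SiteSet p N,
    (if i ∈ T.1 ∧ j ∈ T.1.erase i then spinProd x ((T.1.erase i).erase j) else 0) * a T

/-- Uniform bounds on the local fields and their discrete derivatives. -/
structure RegularCouplings (a : SiteSet p N → ℝ) (K ε : ℝ) : Prop where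
  hess_bilinear : ∀ x v : Config N, ∑ i, (∑ j, setHess a x i j * spin v j) ^ 2 ≤ K * N
  hess_row : ∀ (x : Config N) (i : Fin N), ∑ j, setHess a x i j ^ 2 ≤ K
  field_le : ∀ x : Config N, ∑ i, setField a x i ^ 2 ≤ K * N
  field_ge : ∀ (x : Config N) (I : Finset (Fin N)), N ≤ 2 * I.card →
    ε * N ≤ ∑ i ∈ I, setField a x i ^ 2

lemma card_siteSet_superset (s : Finset (Fin N)) (hs : s.card ≤ p) :
    (Finset.univ.filter fun T : SiteSet p N => s ⊆ T.1).card
      = (N - s.card).choose (p - s.card) := by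
  have h := Finset.card_filter_powersetCard_subset s Finset.univ p (Finset.subset_univ _) hs
  rw [Finset.card_univ, Fintype.card_fin] at h
  rw [← h]
  refine Finset.card_bij (fun T _ => T.1) ?_ ?_ ?_
  · intro T hT
    simp only [Finset.mem_filter, Finset.mem_univ, true_and, Finset.mem_powersetCard] at hT ⊢
    exact ⟨⟨Finset.subset_univ _, T.2⟩, hT⟩
  · intro T _ T' _ h
    exact Subtype.ext h
  · intro T hT
    simp only [Finset.mem_filter, Finset.mem_powersetCard] at hT
    exact ⟨⟨T, hT.1.2⟩, by simpa using hT.2, rfl⟩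

lemma card_siteSet_mem_le (hp : 1 ≤ p) (i : Fin N) :
    ((Finset.univ.filter fun T : SiteSet p N => i ∈ T.1).card : ℝ) ≤ (N : ℝ) ^ (p - 1) := by
  have h := card_siteSet_superset (p := p) {i} (by simpa using hp)
  simp only [Finset.singleton_subset_iff, Finset.card_singleton] at h
  rw [h]
  exact_mod_cast (Nat.choose_le_pow _ _).trans (Nat.pow_le_pow_left (Nat.sub_le _ _) _)

lemma card_siteSet_mem_mem_le (hp : 2 ≤ p) {i j : Fin N} (hij : i ≠ j) :
    ((Finset.univ.filter fun T : SiteSet p N => i ∈ T.1 ∧ j ∈ T.1).card : ℝ)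
      ≤ (N : ℝ) ^ (p - 2) := by
  have h := card_siteSet_superset (p := p) {i, j} (by rw [Finset.card_pair hij]; exact hp)
  simp only [Finset.insert_subset_iff, Finset.singleton_subset_iff, Finset.card_pair hij] at h
  rw [h]
  exact_mod_cast (Nat.choose_le_pow _ _).trans (Nat.pow_le_pow_left (Nat.sub_le _ _) _)

/-- Variance bound for a linear image of the couplings, localized on the site sets. -/
lemma sum_sq_linear_le (A : Fin N → SiteSet p N → ℝ) {D : ℝ}
    (hsupp : ∀ i T, i ∉ T.1 → A i T = 0) (hD : ∀ i, ∑ T, A i T ^ 2 ≤ D) (u : Fin N → ℝ) :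
    ∑ T, (∑ i, u i * A i T) ^ 2 ≤ p * D * ∑ i, u i ^ 2 := by
  -- Cauchy–Schwarz over the `p` sites of `T`, the only ones that contribute.
  have h1 : ∀ T : SiteSet p N, (∑ i, u i * A i T) ^ 2 ≤ p * ∑ i, u i ^ 2 * A i T ^ 2 := by
    intro T
    have e1 : ∑ i, u i * A i T = ∑ i ∈ T.1, u i * A i T :=
      (Finset.sum_subset (Finset.subset_univ _)
        (fun i _ hi => by rw [hsupp i T hi, mul_zero])).symm
    have e2 : ∑ i, u i ^ 2 * A i T ^ 2 = ∑ i ∈ T.1, (u i * A i T) ^ 2 := by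
      simp_rw [← mul_pow]
      exact (Finset.sum_subset (Finset.subset_univ _)
        (fun i _ hi => by rw [hsupp i T hi]; simp)).symm
    rw [e1, e2]
    have := sq_sum_le_card_mul_sum_sq (s := T.1) (f := fun i => u i * A i T)
    rwa [T.2] at this
  calc ∑ T, (∑ i, u i * A i T) ^ 2 ≤ ∑ T : SiteSet p N, p * ∑ i, u i ^ 2 * A i T ^ 2 :=
        Finset.sum_le_sum fun T _ => h1 T
    _ = p * ∑ i, u i ^ 2 * ∑ T, A i T ^ 2 := by
        rw [← Finset.mul_sum, Finset.sum_comm]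
        simp_rw [Finset.mul_sum]
    _ ≤ p * ∑ i, u i ^ 2 * D := by
        gcongr with i _
        exact hD i
    _ = _ := by rw [← Finset.sum_mul]; ring

/-- The identity behind the lower variance bound. -/
lemma sum_siteSet_sq_sum (hp : 2 ≤ p) (hpN : p ≤ N) (w : Fin N → ℝ) :
    ∑ T : SiteSet p N, (∑ i ∈ T.1, w i) ^ 2
      = ((N - 2).choose (p - 1) : ℕ) * ∑ i, w i ^ 2
        + ((N - 2).choose (p - 2) : ℕ) * (∑ i, w i) ^ 2 := by
  -- By Pascal's rule the diagonal count exceeds the off-diagonal one by `(N - 2).choose (p - 1)`.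
  have hcount : ∀ i j : Fin N, ∑ T : SiteSet p N, (if i ∈ T.1 ∧ j ∈ T.1 then (1 : ℝ) else 0)
      = (if i = j then (((N - 2).choose (p - 1) : ℕ) : ℝ) else 0)
        + ((N - 2).choose (p - 2) : ℕ) := by
    intro i j
    rw [Finset.sum_boole]
    split_ifs with hij
    · subst hij
      have h := card_siteSet_superset (p := p) {i} (by simp; omega)
      simp only [Finset.singleton_subset_iff, Finset.card_singleton] at h
      simp only [and_self]
      rw [h]
      obtain ⟨n, rfl⟩ : ∃ n, N = n + 2 := ⟨N - 2, by omega⟩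
      obtain ⟨q, rfl⟩ : ∃ q, p = q + 2 := ⟨p - 2, by omega⟩
      norm_cast
      simp only [Nat.add_sub_cancel, show n + 2 - 1 = n + 1 from rfl,
        show q + 2 - 1 = q + 1 from rfl]
      rw [Nat.choose_succ_succ, add_comm]
    · have h := card_siteSet_superset (p := p) {i, j} (by rw [Finset.card_pair hij]; exact hp)
      simp only [Finset.insert_subset_iff, Finset.singleton_subset_iff,
        Finset.card_pair hij] at h
      rw [h, zero_add]
  have hexp : ∀ T : SiteSet p N, (∑ i ∈ T.1, w i) ^ 2
      = ∑ i, ∑ j, (if i ∈ T.1 ∧ j ∈ T.1 then (1 : ℝ) else 0) * (w i * w j) := by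
    intro T
    have : ∑ i ∈ T.1, w i = ∑ i, if i ∈ T.1 then w i else 0 := by simp
    rw [this, sq, Finset.sum_mul_sum]
    refine Finset.sum_congr rfl fun i _ => Finset.sum_congr rfl fun j _ => ?_
    by_cases hi : i ∈ T.1 <;> by_cases hj : j ∈ T.1 <;> simp [hi, hj]
  simp_rw [hexp]
  rw [Finset.sum_comm]
  calc _ = ∑ i, ∑ j, ∑ T : SiteSet p N,
        (if i ∈ T.1 ∧ j ∈ T.1 then (1 : ℝ) else 0) * (w i * w j) :=
        Finset.sum_congr rfl fun i _ => Finset.sum_comm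
    _ = ∑ i, ∑ j, ((if i = j then (((N - 2).choose (p - 1) : ℕ) : ℝ) else 0)
        + ((N - 2).choose (p - 2) : ℕ)) * (w i * w j) := by
        simp_rw [← Finset.sum_mul, hcount]
    _ = _ := by
        simp_rw [add_mul, Finset.sum_add_distrib, ite_mul, zero_mul, Finset.sum_ite_eq,
          Finset.mem_univ, if_true, ← Finset.mul_sum, ← Finset.sum_mul]
        ring_nf

/-- Lower variance bound for the local fields. -/
lemma choose_mul_sum_sq_le (hp : 2 ≤ p) (hpN : p ≤ N) (x : Config N) (I : Finset (Fin N))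
    (u : I → ℝ) :
    ((N - 2).choose (p - 1) : ℕ) * ∑ i, u i ^ 2
      ≤ ∑ T : SiteSet p N,
        (∑ i : I, u i * (if i.1 ∈ T.1 then spinProd x (T.1.erase i) else 0)) ^ 2 := by
  classical
  -- Erasing `i` from `T` multiplies the spin product by `spin x i`; the common sign `spinProd x
  -- T.1` disappears on squaring.
  set w : Fin N → ℝ := fun i => if h : i ∈ I then u ⟨i, h⟩ * spin x i else 0 with hw
  have hT : ∀ T : SiteSet p N,
      (∑ i : I, u i * (if i.1 ∈ T.1 then spinProd x (T.1.erase i) else 0)) ^ 2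
        = (∑ i ∈ T.1, w i) ^ 2 := by
    intro T
    have : ∑ i : I, u i * (if i.1 ∈ T.1 then spinProd x (T.1.erase i) else 0)
        = spinProd x T.1 * ∑ i ∈ T.1, w i := by
      have e1 : ∑ i ∈ T.1, w i = ∑ i : I, if i.1 ∈ T.1 then w i else 0 := by
        rw [Finset.sum_coe_sort I (fun i => if i ∈ T.1 then w i else 0), ← Finset.sum_filter]
        symm
        apply Finset.sum_subset
        · intro i hi
          exact (Finset.mem_filter.mp hi).2
        · intro i hi hi'
          have : i ∉ I := fun h => hi' (Finset.mem_filter.mpr ⟨h, hi⟩)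
          simp [hw, this]
      rw [e1, Finset.mul_sum]
      refine Finset.sum_congr rfl fun i _ => ?_
      split_ifs with h
      · rw [spinProd_erase x h]
        simp only [hw, i.2, dif_pos]
        ring
      · simp
    rw [this, mul_pow, spinProd_sq, one_mul]
  simp_rw [hT]
  rw [sum_siteSet_sq_sum hp hpN]
  have e2 : ∑ i, w i ^ 2 = ∑ i : I, u i ^ 2 := by
    have : ∑ i, w i ^ 2 = ∑ i ∈ I, w i ^ 2 :=
      (Finset.sum_subset (Finset.subset_univ _) (fun i _ hi => by simp [hw, hi])).symm
    rw [this, ← Finset.sum_coe_sort I (fun i => w i ^ 2)]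
    refine Finset.sum_congr rfl fun i _ => ?_
    simp only [hw, i.2, dif_pos]
    rw [mul_pow, sq (spin x i), spin_mul_self, mul_one]
  rw [e2]
  have : 0 ≤ (((N - 2).choose (p - 2) : ℕ) : ℝ) * (∑ i, w i) ^ 2 := by positivity
  linarith

end Reduced

/-! ### Regularity of Gaussian couplings with exponentially small failure probability -/

section Couplings

variable {p N : ℕ}

/-- The factor `N^{(1-p)/2} (p-1)!` in front of the coupling of a site set. -/
noncomputable def skScale (p N : ℕ) : ℝ :=
  (N : ℝ) ^ ((1 - (p : ℝ)) / 2) * ((p - 1).factorial : ℝ)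

/-- A site lies in at most `N ^ (p - 1)` site sets, so this normalization keeps the variance of a
local field bounded. -/
lemma skScale_sq_mul (hp : 1 ≤ p) (hN : 1 ≤ N) :
    skScale p N ^ 2 * (N : ℝ) ^ (p - 1) = ((p - 1).factorial : ℝ) ^ 2 := by
  have hN' : (0 : ℝ) < N := by exact_mod_cast hN
  have h : ((N : ℝ) ^ ((1 - (p : ℝ)) / 2)) ^ 2 * (N : ℝ) ^ (p - 1) = 1 := by
    rw [← Real.rpow_natCast _ (p - 1), ← Real.rpow_mul_natCast hN'.le, ← Real.rpow_add hN']
    convert Real.rpow_zero (N : ℝ) using 2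
    rw [Nat.cast_sub hp]
    push_cast
    ring
  rw [skScale, mul_pow, mul_right_comm, h, one_mul]

lemma skScale_sq_mul' (hp : 2 ≤ p) (hN : 1 ≤ N) :
    skScale p N ^ 2 * (N : ℝ) ^ (p - 2) = ((p - 1).factorial : ℝ) ^ 2 / N := by
  have hN' : (0 : ℝ) < N := by exact_mod_cast hN
  rw [eq_div_iff hN'.ne', ← skScale_sq_mul (by omega) hN, mul_assoc, ← pow_succ]
  congr 3
  omega

lemma setField_smul (c : ℝ) (y : SiteSet p N → ℝ) (x : Config N) (i : Fin N) :
    setField (fun T => c * y T) x i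
      = ∑ T, (c * if i ∈ T.1 then spinProd x (T.1.erase i) else 0) * y T := by
  unfold setField
  exact Finset.sum_congr rfl fun T _ => by ring

lemma setHess_smul (c : ℝ) (y : SiteSet p N → ℝ) (x : Config N) (i j : Fin N) :
    setHess (fun T => c * y T) x i j
      = ∑ T, (c * if i ∈ T.1 ∧ j ∈ T.1.erase i then
          spinProd x ((T.1.erase i).erase j) else 0) * y T := by
  unfold setHess
  exact Finset.sum_congr rfl fun T _ => by ring

lemma eighth_pow_eq (N : ℕ) :
    ENNReal.ofReal ((1 / 16 : ℝ) ^ N) * 2 ^ N = (1 / 8) ^ N := by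
  rw [ENNReal.ofReal_pow (by norm_num), ← mul_pow]
  congr 1
  rw [one_div, one_div, ENNReal.ofReal_inv_of_pos (by norm_num)]
  have : ENNReal.ofReal 16 = 8 * 2 := by norm_num
  rw [this, ENNReal.mul_inv (by norm_num) (by norm_num), mul_assoc,
    ENNReal.inv_mul_cancel (by norm_num) (by norm_num), mul_one]

lemma exp_neg_le_sixteenth_pow (N : ℕ) : Real.exp (-(4 * N)) ≤ (1 / 16) ^ N := by
  have h2 : (2 : ℝ) ≤ Real.exp 1 := by linarith [Real.add_one_le_exp 1]
  have : Real.exp (-(4 * (N : ℝ))) = ((Real.exp 1)⁻¹ ^ 4) ^ N := by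
    rw [← Real.exp_neg, ← Real.exp_nat_mul, ← Real.exp_nat_mul]
    congr 1
    push_cast
    ring
  rw [this]
  gcongr
  calc (Real.exp 1)⁻¹ ^ 4 ≤ (2 : ℝ)⁻¹ ^ 4 := by gcongr
    _ = 1 / 16 := by norm_num

/-- The tail bound is taken at level `r = 4 N`: `exp (-4 N)` absorbs the factor `2 ^ N` and leaves a
rate that survives a union over `4 ^ N` events. -/
lemma upper_tail (hp : 1 ≤ p) (A : Fin N → SiteSet p N → ℝ) {D K : ℝ} (hD0 : 0 < D)
    (hsupp : ∀ i T, i ∉ T.1 → A i T = 0) (hD : ∀ i, ∑ T, A i T ^ 2 ≤ D)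
    (hK : 16 * p * D * N ≤ K) :
    stdGaussianPi (SiteSet p N) {y | K < ∑ i, (∑ T, A i T * y T) ^ 2} ≤ (1 / 8) ^ N := by
  have hp' : (0 : ℝ) < p := by exact_mod_cast hp
  have h := stdGaussianPi_quadratic_ge A (mul_pos hp' hD0) (sum_sq_linear_le A hsupp hD) (4 * N)
  rw [Fintype.card_fin] at h
  calc _ ≤ stdGaussianPi (SiteSet p N) {y | 4 * (p * D) * (4 * N) < ∑ i, (∑ T, A i T * y T) ^ 2} :=
        measure_mono fun y (hy : K < _) => lt_of_le_of_lt (by linarith) hy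
    _ ≤ _ := h
    _ ≤ ENNReal.ofReal ((1 / 16 : ℝ) ^ N) * 2 ^ N := by
        gcongr
        exact exp_neg_le_sixteenth_pow N
    _ = _ := eighth_pow_eq N

lemma sum_sq_mem_le (hp : 1 ≤ p) (hN : 1 ≤ N) {A : SiteSet p N → ℝ} {b : ℝ} {i : Fin N}
    (hA : ∀ T, |A T| ≤ if i ∈ T.1 then |skScale p N| * b else 0) :
    ∑ T, A T ^ 2 ≤ b ^ 2 * ((p - 1).factorial : ℝ) ^ 2 := by
  calc ∑ T, A T ^ 2 ≤ ∑ T : SiteSet p N, if i ∈ T.1 then skScale p N ^ 2 * b ^ 2 else 0 := by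
        refine Finset.sum_le_sum fun T _ => ?_
        have := hA T
        split_ifs at this ⊢ with h
        · rw [← sq_abs, ← sq_abs (skScale p N), ← mul_pow]
          exact pow_le_pow_left₀ (abs_nonneg _) this 2
        · simp [abs_nonpos_iff.mp this]
    _ = (Finset.univ.filter fun T : SiteSet p N => i ∈ T.1).card
          * (skScale p N ^ 2 * b ^ 2) := by
        rw [← Finset.sum_filter, Finset.sum_const, nsmul_eq_mul]
    _ ≤ (N : ℝ) ^ (p - 1) * (skScale p N ^ 2 * b ^ 2) := by
        gcongr
        exact card_siteSet_mem_le hp i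
    _ = _ := by rw [← skScale_sq_mul hp hN]; ring

/-- The constant in the upper bounds of the regularity event. -/
noncomputable def upperConst (p : ℕ) : ℝ := 16 * p * ((p : ℝ) ^ 2 * ((p - 1).factorial : ℝ) ^ 2)

lemma upperConst_pos (hp : 1 ≤ p) : 0 < upperConst p := by
  have hp' : (0 : ℝ) < p := by exact_mod_cast hp
  have := Nat.factorial_pos (p - 1)
  unfold upperConst
  positivity

lemma field_upper_tail (hp : 1 ≤ p) (hN : 1 ≤ N) (x : Config N) :
    stdGaussianPi (SiteSet p N)
      {y | upperConst p * N < ∑ i, setField (fun T => skScale p N * y T) x i ^ 2}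
      ≤ (1 / 8) ^ N := by
  have hp' : (1 : ℝ) ≤ p := by exact_mod_cast hp
  have hf : (0 : ℝ) < ((p - 1).factorial : ℝ) := by exact_mod_cast Nat.factorial_pos (p - 1)
  simp_rw [setField_smul]
  refine upper_tail hp _ (D := 1 ^ 2 * ((p - 1).factorial : ℝ) ^ 2) (by positivity) ?_ ?_ ?_
  · intro i T hi
    simp [hi]
  · intro i
    refine sum_sq_mem_le hp hN (i := i) fun T => ?_
    split_ifs
    · rw [abs_mul, abs_spinProd]
    · simp
  · unfold upperConst
    gcongr

/-- Each site set receives at most `p` terms of the sum over `j`, hence the extra factor `p ^ 2` in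
the variance. -/
lemma hess_upper_tail (hp : 1 ≤ p) (hN : 1 ≤ N) (x v : Config N) :
    stdGaussianPi (SiteSet p N)
      {y | upperConst p * N <
        ∑ i, (∑ j, setHess (fun T => skScale p N * y T) x i j * spin v j) ^ 2}
      ≤ (1 / 8) ^ N := by
  have hp' : (1 : ℝ) ≤ p := by exact_mod_cast hp
  have hf : (0 : ℝ) < ((p - 1).factorial : ℝ) := by exact_mod_cast Nat.factorial_pos (p - 1)
  have hrw : ∀ (y : SiteSet p N → ℝ) (i : Fin N),
      ∑ j, setHess (fun T => skScale p N * y T) x i j * spin v j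
        = ∑ T, (∑ j, (skScale p N * if i ∈ T.1 ∧ j ∈ T.1.erase i then
          spinProd x ((T.1.erase i).erase j) else 0) * spin v j) * y T := by
    intro y i
    simp_rw [setHess_smul, Finset.sum_mul]
    rw [Finset.sum_comm]
    exact Finset.sum_congr rfl fun T _ => Finset.sum_congr rfl fun j _ => by ring
  simp_rw [hrw]
  refine upper_tail hp _ (D := (p : ℝ) ^ 2 * ((p - 1).factorial : ℝ) ^ 2) (by positivity) ?_ ?_ ?_
  · intro i T hi
    simp [hi]
  · intro i
    refine sum_sq_mem_le hp hN (i := i) fun T => ?_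
    split_ifs with hi
    · calc _ ≤ ∑ j, |(skScale p N * if i ∈ T.1 ∧ j ∈ T.1.erase i then
            spinProd x ((T.1.erase i).erase j) else 0) * spin v j| :=
            Finset.abs_sum_le_sum_abs _ _
        _ ≤ ∑ j, if j ∈ T.1 then |skScale p N| else 0 := by
            refine Finset.sum_le_sum fun j _ => ?_
            rw [abs_mul, abs_spin, mul_one, abs_mul]
            by_cases hj : j ∈ T.1
            · rw [if_pos hj]
              split_ifs
              · rw [abs_spinProd, mul_one]
              · simp
            · simp [hj]
        _ = |skScale p N| * p := by
            rw [← Finset.sum_filter, Finset.sum_const, nsmul_eq_mul,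
              Finset.filter_mem_eq_inter, Finset.univ_inter, T.2, mul_comm]
    · simp [hi]
  · unfold upperConst
    rfl

/-- Two distinct sites share at most `N ^ (p - 2)` site sets, so each entry has variance `O(1 / N)`
and a whole row has bounded square sum. -/
lemma row_upper_tail (hp : 2 ≤ p) (hN : 1 ≤ N) (x : Config N) (i : Fin N) :
    stdGaussianPi (SiteSet p N)
      {y | upperConst p < ∑ j, setHess (fun T => skScale p N * y T) x i j ^ 2}
      ≤ (1 / 8) ^ N := by
  have hp' : (1 : ℝ) ≤ p := by exact_mod_cast (by omega : 1 ≤ p)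
  have hN' : (0 : ℝ) < N := by exact_mod_cast hN
  have hf : (0 : ℝ) < ((p - 1).factorial : ℝ) := by exact_mod_cast Nat.factorial_pos (p - 1)
  simp_rw [setHess_smul]
  refine upper_tail (by omega) _ (D := ((p - 1).factorial : ℝ) ^ 2 / N) (by positivity) ?_ ?_ ?_
  · intro j T hj
    simp [hj]
  · intro j
    by_cases hij : i = j
    · subst hij
      simp only [Finset.notMem_erase, and_false, if_false, mul_zero]
      simp only [ne_eq, OfNat.ofNat_ne_zero, not_false_eq_true, zero_pow, Finset.sum_const_zero]
      positivity
    calc _ ≤ ∑ T : SiteSet p N, if i ∈ T.1 ∧ j ∈ T.1 then skScale p N ^ 2 else 0 := by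
          refine Finset.sum_le_sum fun T _ => ?_
          by_cases h : i ∈ T.1 ∧ j ∈ T.1
          · have h' : i ∈ T.1 ∧ j ∈ T.1.erase i :=
              ⟨h.1, Finset.mem_erase.mpr ⟨Ne.symm hij, h.2⟩⟩
            rw [if_pos h, if_pos h', mul_pow, spinProd_sq, mul_one]
          · have h' : ¬ (i ∈ T.1 ∧ j ∈ T.1.erase i) := fun h' =>
              h ⟨h'.1, Finset.mem_of_mem_erase h'.2⟩
            rw [if_neg h, if_neg h']
            simp
      _ = (Finset.univ.filter fun T : SiteSet p N => i ∈ T.1 ∧ j ∈ T.1).card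
          * skScale p N ^ 2 := by
          rw [← Finset.sum_filter, Finset.sum_const, nsmul_eq_mul]
      _ ≤ (N : ℝ) ^ (p - 2) * skScale p N ^ 2 := by
          gcongr
          exact card_siteSet_mem_mem_le hp hij
      _ = _ := by rw [mul_comm, skScale_sq_mul' hp hN]
  · unfold upperConst
    calc 16 * (p : ℝ) * (((p - 1).factorial : ℝ) ^ 2 / N) * N
        = 16 * p * (1 ^ 2 * ((p - 1).factorial : ℝ) ^ 2) := by field_simp
      _ ≤ _ := by gcongr

/-- The constant in the lower bound of the regularity event. -/
noncomputable def lowerConst (p : ℕ) : ℝ := (1 / 2) ^ (p - 1) / 2 ^ 16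

lemma lowerConst_pos : 0 < lowerConst p := by unfold lowerConst; positivity

lemma half_pow_le_variance (hp : 2 ≤ p) (hN : 2 * p ≤ N) :
    (1 / 2 : ℝ) ^ (p - 1) ≤ skScale p N ^ 2 * ((N - 2).choose (p - 1) : ℕ) := by
  have hf : (1 : ℝ) ≤ ((p - 1).factorial : ℝ) := by exact_mod_cast Nat.factorial_pos (p - 1)
  have hN' : (0 : ℝ) < N := by exact_mod_cast (by omega : 0 < N)
  have h1 := Nat.pow_le_choose (α := ℝ) (p - 1) (N - 2)
  -- The right side is `N - p`; this is where `2 * p ≤ N` enters.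
  have h2 : (N : ℝ) / 2 ≤ ((N - 2 + 1 - (p - 1) : ℕ) : ℝ) := by
    have : N ≤ 2 * (N - 2 + 1 - (p - 1)) := by omega
    have : (N : ℝ) ≤ 2 * ((N - 2 + 1 - (p - 1) : ℕ) : ℝ) := by exact_mod_cast this
    linarith
  have h3 : ((N : ℝ) / 2) ^ (p - 1) / ((p - 1).factorial : ℝ) ≤ ((N - 2).choose (p - 1) : ℕ) := by
    refine le_trans ?_ h1
    gcongr
  calc (1 / 2 : ℝ) ^ (p - 1) ≤ (1 / 2 : ℝ) ^ (p - 1) * ((p - 1).factorial : ℝ) :=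
        le_mul_of_one_le_right (by positivity) hf
    _ = skScale p N ^ 2 * (((N : ℝ) / 2) ^ (p - 1) / ((p - 1).factorial : ℝ)) := by
        have := skScale_sq_mul (p := p) (N := N) (by omega) (by omega)
        rw [div_pow, div_pow, one_pow]
        field_simp
        linarith
    _ ≤ _ := by gcongr

lemma field_lower_tail (hp : 2 ≤ p) (hN : 2 * p ≤ N) (x : Config N) (I : Finset (Fin N))
    (hI : N ≤ 2 * I.card) :
    stdGaussianPi (SiteSet p N)
      {y | ∑ i ∈ I, setField (fun T => skScale p N * y T) x i ^ 2 < lowerConst p * N}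
      ≤ (1 / 8) ^ N := by
  simp_rw [setField_smul]
  set τ : ℝ := (1 / 2) ^ (p - 1) with hτ
  have hτ0 : 0 < τ := by positivity
  -- With this `l` each site contributes a factor at most `2 ^ (-8)`. Having only `N / 2` sites
  -- still gives `16 ^ (-N)`, against a prefactor `exp (N / 2) ≤ 2 ^ N`.
  have h := stdGaussianPi_quadratic_le (κ := SiteSet p N) (ι := I) (τ := τ) (l := 2 ^ 16 / τ)
    (fun i T => skScale p N * if i.1 ∈ T.1 then spinProd x (T.1.erase i) else 0)
    hτ0 (by positivity) ?_ (lowerConst p * N)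
  · have hs : ∀ y : SiteSet p N → ℝ,
        ∑ i : I, (∑ T, (skScale p N * if i.1 ∈ T.1 then spinProd x (T.1.erase i) else 0) * y T) ^ 2
          = ∑ i ∈ I, (∑ T, (skScale p N * if i ∈ T.1 then spinProd x (T.1.erase i) else 0)
            * y T) ^ 2 := fun y =>
      Finset.sum_coe_sort I (fun i => (∑ T : SiteSet p N,
        (skScale p N * if i ∈ T.1 then spinProd x (T.1.erase i) else 0) * y T) ^ 2)
    simp_rw [hs] at h
    refine h.trans ?_
    rw [← eighth_pow_eq, ← ENNReal.ofReal_ofNat 2, ← ENNReal.ofReal_pow (by norm_num),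
      ← ENNReal.ofReal_mul (by positivity), Fintype.card_coe]
    refine ENNReal.ofReal_le_ofReal ?_
    rw [mul_comm]
    have e1 : 2 ^ 16 / τ * (lowerConst p * N) / 2 = N * (1 / 2) := by
      unfold lowerConst
      rw [← hτ]
      field_simp
    have e2 : 2 ^ 16 / τ * τ = 2 ^ 16 := by field_simp
    rw [e1, e2, Real.exp_nat_mul]
    have h8 : (2 ^ 8 : ℝ) ≤ √(1 + 2 ^ 16) := Real.le_sqrt_of_sq_le (by norm_num)
    have hexp : Real.exp (1 / 2) ≤ 2 := by
      have := Real.exp_one_lt_d9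
      have h' : Real.exp (1 / 2) ^ 2 = Real.exp 1 := by
        rw [← Real.exp_nat_mul]; norm_num
      nlinarith [Real.exp_pos (1 / 2)]
    gcongr
    calc (√(1 + 2 ^ 16))⁻¹ ^ I.card ≤ ((2 : ℝ) ^ 8)⁻¹ ^ I.card := by gcongr
      _ = (1 / 16) ^ (2 * I.card) := by
          rw [pow_mul]; norm_num
      _ ≤ (1 / 16) ^ N := pow_le_pow_of_le_one (by norm_num) (by norm_num) hI
  · intro u
    have h1 := choose_mul_sum_sq_le hp (by omega) x I u
    have h2 := half_pow_le_variance hp hN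
    calc τ * ∑ i, u i ^ 2
        ≤ skScale p N ^ 2 * ((N - 2).choose (p - 1) : ℕ) * ∑ i, u i ^ 2 := by gcongr
      _ ≤ skScale p N ^ 2 * ∑ T : SiteSet p N,
        (∑ i : I, u i * (if i.1 ∈ T.1 then spinProd x (T.1.erase i) else 0)) ^ 2 := by
          rw [mul_assoc]; gcongr
      _ = _ := by
          rw [Finset.mul_sum]
          refine Finset.sum_congr rfl fun T _ => ?_
          rw [← mul_pow, Finset.mul_sum]
          congr 1
          exact Finset.sum_congr rfl fun i _ => by ring

lemma measure_iUnion_le_half_pow {α β : Type*} [MeasurableSpace α] (ν : Measure α) [Fintype β]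
    (hβ : Fintype.card β ≤ 4 ^ N) (s : β → Set α) (hs : ∀ b, ν (s b) ≤ (1 / 8) ^ N) :
    ν (⋃ b, s b) ≤ (1 / 2) ^ N := by
  calc ν (⋃ b, s b) ≤ ∑ b, ν (s b) := measure_iUnion_fintype_le ν s
    _ ≤ ∑ _b : β, (1 / 8 : ENNReal) ^ N := Finset.sum_le_sum fun b _ => hs b
    _ = (Fintype.card β : ENNReal) * (1 / 8) ^ N := by
        rw [Finset.sum_const, nsmul_eq_mul, Finset.card_univ]
    _ ≤ 4 ^ N * (1 / 8) ^ N := by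
        gcongr
        exact_mod_cast hβ
    _ = _ := by
        rw [← mul_pow]
        congr 1
        rw [one_div, one_div, show (8 : ENNReal) = 4 * 2 by norm_num,
          ENNReal.mul_inv (by norm_num) (by norm_num), ← mul_assoc,
          ENNReal.mul_inv_cancel (by norm_num) (by norm_num), one_mul]

lemma card_config (N : ℕ) : Fintype.card (Config N) = 2 ^ N := by
  simp [Config]

/-- The four conditions are indexed by pairs of configurations, a configuration and a site, a
configuration, and a configuration with a set of sites: at most `4 ^ N` indices each. -/
lemma not_regular_measure_le (hp : 2 ≤ p) (hN : 2 * p ≤ N) :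
    stdGaussianPi (SiteSet p N) {y | ¬ RegularCouplings (fun T => skScale p N * y T)
      (upperConst p) (lowerConst p)} ≤ 4 * (1 / 2) ^ N := by
  have h42 : (4 : ℕ) ^ N = 2 ^ N * 2 ^ N := by rw [← mul_pow]; norm_num
  have hN1 : 1 ≤ N := by omega
  have b1 := measure_iUnion_le_half_pow (N := N) (β := Config N × Config N)
    (stdGaussianPi (SiteSet p N)) (by simp [h42]) _
    (fun z => hess_upper_tail (by omega) hN1 z.1 z.2)
  have b2 := measure_iUnion_le_half_pow (N := N) (β := Config N × Fin N)
    (stdGaussianPi (SiteSet p N))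
    (by
      rw [Fintype.card_prod, card_config, Fintype.card_fin, h42]
      exact Nat.mul_le_mul_left _ N.lt_two_pow_self.le) _
    (fun z => row_upper_tail hp hN1 z.1 z.2)
  have b3 := measure_iUnion_le_half_pow (N := N) (β := Config N)
    (stdGaussianPi (SiteSet p N))
    (by rw [card_config]; exact Nat.pow_le_pow_left (by norm_num) _) _
    (fun z => field_upper_tail (by omega) hN1 z)
  have b4 := measure_iUnion_le_half_pow (N := N)
    (β := Config N × {I : Finset (Fin N) // N ≤ 2 * I.card})
    (stdGaussianPi (SiteSet p N))
    (by
      rw [Fintype.card_prod, card_config, h42]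
      refine Nat.mul_le_mul_left _ ((Fintype.card_subtype_le _).trans ?_)
      simp) _
    (fun z => field_lower_tail hp hN z.1 z.2.1 z.2.2)
  refine (measure_mono ?_).trans ((measure_union_le _ _).trans (add_le_add
    ((measure_union_le _ _).trans (add_le_add b1 b2))
    ((measure_union_le _ _).trans (add_le_add b3 b4)))) |>.trans (le_of_eq (by ring))
  intro y hy
  by_contra hcon
  simp only [Set.mem_union, Set.mem_iUnion, Set.mem_ofPred_eq, not_or, not_exists, not_lt,
    Prod.forall, Subtype.forall] at hcon
  exact hy ⟨hcon.1.1, hcon.1.2, hcon.2.1, hcon.2.2⟩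

end Couplings

/-! ### Almost sure regularity of the disorder -/

section Disorder

variable {p N : ℕ}

/-- The set of natural numbers underlying a set of sites. -/
def siteIndex (T : SiteSet p N) : CouplingIndex p :=
  ⟨T.1.image Fin.val, (Finset.card_image_of_injective _ Fin.val_injective).trans T.2⟩

lemma siteIndex_injective : Function.Injective (siteIndex : SiteSet p N → CouplingIndex p) := by
  intro T T' h
  have := congrArg Subtype.val h
  exact Subtype.ext (Finset.image_injective Fin.val_injective this)

/-- The coupling of a site set in the `p`-spin model. -/
noncomputable def skCoupling (g : CouplingIndex p → ℝ) (N : ℕ) (T : SiteSet p N) : ℝ :=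
  skScale p N * g (siteIndex T)

theorem ae_eventually_regularCouplings {Ω : Type*} [MeasurableSpace Ω] (μ : Measure Ω)
    [IsProbabilityMeasure μ] (hp : 2 ≤ p) (g : CouplingIndex p → Ω → ℝ)
    (hlaw : ∀ S, HasLaw (g S) (gaussianReal 0 1) μ) (hindep : iIndepFun g μ) :
    ∀ᵐ ω ∂μ, ∀ᶠ N : ℕ in atTop, RegularCouplings (skCoupling (fun S => g S ω) N)
      (upperConst p) (lowerConst p) := by
  have hbound : ∀ N : ℕ, μ {ω | ¬ RegularCouplings (skCoupling (fun S => g S ω) (N + 2 * p))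
      (upperConst p) (lowerConst p)} ≤ 4 * (1 / 2) ^ N := by
    intro N
    have hae : ∀ T : SiteSet p (N + 2 * p), AEMeasurable (g (siteIndex T)) μ :=
      fun T => (hlaw _).aemeasurable
    have hmap := (iIndepFun_iff_map_fun_eq_pi_map hae).mp (hindep.precomp siteIndex_injective)
    simp_rw [(hlaw _).map_eq] at hmap
    calc _ ≤ (μ.map fun ω (T : SiteSet p (N + 2 * p)) => g (siteIndex T) ω)
          {y | ¬ RegularCouplings (fun T => skScale p (N + 2 * p) * y T)
            (upperConst p) (lowerConst p)} :=
          -- This direction holds for arbitrary sets, so the regularity event need not be shown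
          -- measurable.
          Measure.le_map_apply (aemeasurable_pi_lambda _ hae) _
      _ ≤ 4 * (1 / 2) ^ (N + 2 * p) := by
          rw [hmap]
          exact not_regular_measure_le hp (by omega)
      _ ≤ _ := by
          gcongr 4 * ?_
          exact pow_le_pow_of_le_one zero_le (by norm_num) (by omega)
  have hsum : ∑' N : ℕ, μ {ω | ¬ RegularCouplings (skCoupling (fun S => g S ω) (N + 2 * p))
      (upperConst p) (lowerConst p)} ≠ ⊤ := by
    refine ne_top_of_le_ne_top ?_ (ENNReal.tsum_le_tsum hbound)
    rw [ENNReal.tsum_mul_left, ENNReal.tsum_geometric]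
    refine ENNReal.mul_ne_top (by norm_num) (ENNReal.inv_ne_top.mpr ?_)
    rw [one_div, ENNReal.one_sub_inv_two]
    exact ENNReal.inv_ne_zero.mpr (by norm_num)
  filter_upwards [ae_eventually_notMem hsum] with ω hω
  -- Borel–Cantelli was applied to sizes shifted by `2 * p`, where the tail bounds are valid.
  rw [← map_add_atTop_eq_nat (2 * p), eventually_map]
  filter_upwards [hω] with N hN
  simpa using hN

end Disorder

/-! ### Estimates for `tanh` and `u tanh u` -/

section Tanh

lemma hasDerivAt_tanh (u : ℝ) : HasDerivAt Real.tanh (1 - Real.tanh u ^ 2) u := by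
  have h := (Real.hasDerivAt_sinh u).div (Real.hasDerivAt_cosh u) (Real.cosh_pos u).ne'
  have hc := (Real.cosh_pos u).ne'
  have e : (fun y => Real.sinh y / Real.cosh y) = Real.tanh := by
    funext y; exact (Real.tanh_eq_sinh_div_cosh y).symm
  have h' : HasDerivAt (fun y => Real.sinh y / Real.cosh y)
      ((Real.cosh u * Real.cosh u - Real.sinh u * Real.sinh u) / Real.cosh u ^ 2) u := h
  rw [e] at h'
  convert h' using 1
  rw [Real.tanh_eq_sinh_div_cosh]
  field_simp

lemma one_sub_tanh_sq_pos (u : ℝ) : 0 < 1 - Real.tanh u ^ 2 := by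
  linarith [Real.tanh_sq_lt_one u]

lemma tanh_strictMono : StrictMono Real.tanh :=
  strictMono_of_hasDerivAt_pos hasDerivAt_tanh one_sub_tanh_sq_pos

lemma continuous_tanh : Continuous Real.tanh :=
  continuous_iff_continuousAt.mpr fun u => (hasDerivAt_tanh u).continuousAt

/-- Since `1 - tanh² = 1 / cosh²`, it suffices that `|u| ≤ |sinh u| ≤ cosh² u`. -/
lemma abs_mul_one_sub_tanh_sq_le (u : ℝ) : |u * (1 - Real.tanh u ^ 2)| ≤ 1 := by
  have hc := Real.cosh_pos u
  have e : 1 - Real.tanh u ^ 2 = 1 / Real.cosh u ^ 2 := by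
    rw [Real.tanh_eq_sinh_div_cosh]
    field_simp
    exact Real.cosh_sq_sub_sinh_sq u
  rw [abs_mul, abs_of_pos (one_sub_tanh_sq_pos u), e, mul_one_div, div_le_one (by positivity),
    Real.cosh_sq]
  have h1 : |u| ≤ |Real.sinh u| := by
    rcases le_total 0 u with h | h
    · rw [abs_of_nonneg h, abs_of_nonneg (Real.sinh_nonneg_iff.mpr h)]
      exact Real.self_le_sinh_iff.mpr h
    · rw [abs_of_nonpos h, abs_of_nonpos (Real.sinh_nonpos_iff.mpr h)]
      exact neg_le_neg (Real.sinh_le_self_iff.mpr h)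
  nlinarith [sq_abs (Real.sinh u), sq_nonneg (|Real.sinh u| - 1), abs_nonneg (Real.sinh u)]

/-- The derivative of `u tanh u`. -/
noncomputable def mulTanhDeriv (u : ℝ) : ℝ := Real.tanh u + u * (1 - Real.tanh u ^ 2)

lemma hasDerivAt_mul_tanh (u : ℝ) :
    HasDerivAt (fun u => u * Real.tanh u) (mulTanhDeriv u) u := by
  have h : HasDerivAt (fun u => u * Real.tanh u)
      (1 * Real.tanh u + u * (1 - Real.tanh u ^ 2)) u :=
    (hasDerivAt_id' u).mul (hasDerivAt_tanh u)
  rwa [one_mul] at h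

lemma abs_mulTanhDeriv_le (u : ℝ) : |mulTanhDeriv u| ≤ 2 := by
  calc |mulTanhDeriv u| ≤ |Real.tanh u| + |u * (1 - Real.tanh u ^ 2)| := abs_add_le _ _
    _ ≤ 2 := by linarith [Real.abs_tanh_lt_one u, abs_mul_one_sub_tanh_sq_le u]

lemma hasDerivAt_mulTanhDeriv (u : ℝ) :
    HasDerivAt mulTanhDeriv
      (2 * (1 - Real.tanh u ^ 2) - 2 * Real.tanh u * (u * (1 - Real.tanh u ^ 2))) u := by
  have h : HasDerivAt mulTanhDeriv ((1 - Real.tanh u ^ 2) + (1 * (1 - Real.tanh u ^ 2)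
      + u * -((2 : ℕ) * Real.tanh u ^ (2 - 1) * (1 - Real.tanh u ^ 2)))) u :=
    (hasDerivAt_tanh u).add
      ((hasDerivAt_id' u).mul (((hasDerivAt_tanh u).pow 2).const_sub 1))
  convert h using 1
  push_cast
  ring

lemma abs_mulTanhDeriv_sub_le (a b : ℝ) : |mulTanhDeriv a - mulTanhDeriv b| ≤ 4 * |a - b| := by
  refine Convex.norm_image_sub_le_of_norm_hasDerivWithin_le (s := Set.univ)
    (fun u _ => (hasDerivAt_mulTanhDeriv u).hasDerivWithinAt) (fun u _ => ?_) convex_univ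
    (Set.mem_univ _) (Set.mem_univ _)
  rw [Real.norm_eq_abs]
  have h1 := abs_mul_one_sub_tanh_sq_le u
  have h2 := Real.abs_tanh_lt_one u
  have h3 := one_sub_tanh_sq_pos u
  have h4 := sq_nonneg (Real.tanh u)
  calc _ ≤ |2 * (1 - Real.tanh u ^ 2)| + |2 * Real.tanh u * (u * (1 - Real.tanh u ^ 2))| :=
        abs_sub _ _
    _ = 2 * (1 - Real.tanh u ^ 2) + 2 * (|Real.tanh u| * |u * (1 - Real.tanh u ^ 2)|) := by
        rw [abs_of_pos (by linarith), abs_mul (2 * _), abs_mul 2, abs_two, mul_assoc]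
    _ ≤ 2 * 1 + 2 * (1 * 1) := by gcongr; linarith
    _ = 4 := by norm_num

/-- Mean value inequality for `u tanh u` minus its linear part at `a`, whose derivative is at most
`4 |e|` on the segment. -/
lemma abs_mul_tanh_taylor_le (a e : ℝ) :
    |a * Real.tanh a - (a - e) * Real.tanh (a - e) - e * mulTanhDeriv a| ≤ 4 * e ^ 2 := by
  have h := Convex.norm_image_sub_le_of_norm_hasDerivWithin_le (s := Set.uIcc (a - e) a)
    (f := fun u => u * Real.tanh u - u * mulTanhDeriv a)
    (f' := fun u => mulTanhDeriv u - 1 * mulTanhDeriv a) (C := 4 * |e|)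
    (fun u _ => ((hasDerivAt_mul_tanh u).sub
      ((hasDerivAt_id u).mul_const (mulTanhDeriv a))).hasDerivWithinAt)
    (fun u hu => ?_) (convex_uIcc _ _) Set.left_mem_uIcc Set.right_mem_uIcc
  · rw [Real.norm_eq_abs, Real.norm_eq_abs, sub_sub_cancel, mul_assoc, abs_mul_abs_self, ← sq] at h
    convert h using 2
    ring
  · rw [one_mul, Real.norm_eq_abs]
    refine (abs_mulTanhDeriv_sub_le u a).trans ?_
    have := Set.abs_sub_right_of_mem_uIcc hu
    rw [sub_sub_cancel, abs_sub_comm] at this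
    linarith

lemma mul_tanh_mul_mono (m : ℝ) : Monotone fun b => m * Real.tanh (b * m) := by
  intro b b' h
  simp only
  rcases le_total 0 m with hm | hm
  · exact mul_le_mul_of_nonneg_left (tanh_strictMono.monotone (by gcongr)) hm
  · exact mul_le_mul_of_nonpos_left
      (tanh_strictMono.monotone (mul_le_mul_of_nonpos_right h hm)) hm

/-- The `t`-derivative of `m tanh (t m)` is `m² (1 - tanh² (t m))`, and `|t m| ≤ B A` on the
interval. -/
lemma le_mul_tanh_sub {m A B b b' : ℝ} (hm : |m| ≤ A) (hb : 0 ≤ b) (hbb : b ≤ b') (hB : b' ≤ B) :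
    (1 - Real.tanh (B * A) ^ 2) * m ^ 2 * (b' - b)
      ≤ m * Real.tanh (b' * m) - m * Real.tanh (b * m) := by
  have hd : ∀ t, HasDerivAt (fun t => m * Real.tanh (t * m))
      (m * ((1 - Real.tanh (t * m) ^ 2) * (1 * m))) t := fun t =>
    (HasDerivAt.comp (h₂ := Real.tanh) (h := fun t => t * m) t (hasDerivAt_tanh (t * m))
      ((hasDerivAt_id' t).mul_const m)).const_mul m
  refine (convex_Icc (0 : ℝ) B).mul_sub_le_image_sub_of_le_deriv
    (f := fun t => m * Real.tanh (t * m))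
    (fun t _ => (hd t).continuousAt.continuousWithinAt)
    (fun t _ => (hd t).differentiableAt.differentiableWithinAt) (fun t ht => ?_)
    b ⟨hb, hbb.trans hB⟩ b' ⟨hb.trans hbb, hB⟩ hbb
  rw [interior_Icc] at ht
  rw [(hd t).deriv]
  have hA : 0 ≤ A := (abs_nonneg m).trans hm
  have h1 : |t * m| ≤ B * A := by
    rw [abs_mul, abs_of_pos ht.1]
    exact mul_le_mul ht.2.le hm (abs_nonneg _) (ht.1.le.trans ht.2.le)
  have h2 : Real.tanh (t * m) ^ 2 ≤ Real.tanh (B * A) ^ 2 := by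
    rw [sq_le_sq]
    have h3 : |Real.tanh (t * m)| ≤ Real.tanh (B * A) := by
      rw [abs_le] at h1 ⊢
      rw [← Real.tanh_neg]
      exact ⟨tanh_strictMono.monotone h1.1, tanh_strictMono.monotone h1.2⟩
    exact h3.trans (le_abs_self _)
  nlinarith [mul_le_mul_of_nonneg_right h2 (sq_nonneg m)]

end Tanh

/-! ### Effect of a single spin flip -/

section Flip

variable {p N : ℕ}

/-- The configuration with the spin at `i` reversed. -/
def flip (i : Fin N) (x : Config N) : Config N := Function.update x i (-x i)

lemma flip_involutive (i : Fin N) : Function.Involutive (flip i) := by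
  intro x
  simp [flip]

lemma spin_flip_self (i : Fin N) (x : Config N) : spin (flip i x) i = -spin x i := by
  simp [flip, spin]

lemma spin_flip_of_ne {i j : Fin N} (h : j ≠ i) (x : Config N) :
    spin (flip i x) j = spin x j := by
  simp [flip, spin, h]

lemma spinProd_flip_of_notMem {i : Fin N} {S : Finset (Fin N)} (h : i ∉ S) (x : Config N) :
    spinProd (flip i x) S = spinProd x S :=
  Finset.prod_congr rfl fun _ hj => spin_flip_of_ne (ne_of_mem_of_not_mem hj h) x

lemma spinProd_flip_of_mem {i : Fin N} {S : Finset (Fin N)} (h : i ∈ S) (x : Config N) :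
    spinProd (flip i x) S = -spinProd x S := by
  rw [← spin_mul_spinProd_erase _ h, ← spin_mul_spinProd_erase x h, spin_flip_self,
    spinProd_flip_of_notMem (Finset.notMem_erase _ _), neg_mul]

lemma setField_flip_self (a : SiteSet p N → ℝ) (x : Config N) (i : Fin N) :
    setField a (flip i x) i = setField a x i := by
  unfold setField
  simp_rw [spinProd_flip_of_notMem (Finset.notMem_erase i _)]

lemma setHess_self (a : SiteSet p N → ℝ) (x : Config N) (i : Fin N) : setHess a x i i = 0 := by
  simp [setHess]

/-- The field at `j` is affine in the spin at `i`, so this expansion has no remainder. -/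
lemma setField_flip (a : SiteSet p N → ℝ) (x : Config N) (i j : Fin N) :
    setField a (flip i x) j = setField a x j - 2 * spin x i * setHess a x i j := by
  unfold setField setHess
  rw [Finset.mul_sum, ← Finset.sum_sub_distrib]
  refine Finset.sum_congr rfl fun T _ => ?_
  by_cases hj : j ∈ T.1
  · by_cases hi : i ∈ T.1.erase j
    · have h : i ∈ T.1 ∧ j ∈ T.1.erase i :=
        ⟨Finset.mem_of_mem_erase hi, Finset.mem_erase.mpr ⟨(Finset.ne_of_mem_erase hi).symm, hj⟩⟩
      rw [if_pos hj, if_pos hj, if_pos h, spinProd_flip_of_mem hi, Finset.erase_right_comm,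
        ← spin_mul_spinProd_erase x hi]
      ring
    · have h : ¬ (i ∈ T.1 ∧ j ∈ T.1.erase i) := fun h =>
        hi (Finset.mem_erase.mpr ⟨(Finset.ne_of_mem_erase h.2).symm, h.1⟩)
      rw [if_pos hj, if_pos hj, if_neg h, spinProd_flip_of_notMem hi]
      ring
  · have h : ¬ (i ∈ T.1 ∧ j ∈ T.1.erase i) := fun h => hj (Finset.mem_of_mem_erase h.2)
    rw [if_neg hj, if_neg hj, if_neg h]
    ring

/-- The Hamiltonian with couplings indexed by site sets. -/
noncomputable def setEnergy (a : SiteSet p N → ℝ) (x : Config N) : ℝ :=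
  ∑ i, spin x i * setField a x i

lemma setEnergy_eq (a : SiteSet p N → ℝ) (x : Config N) :
    setEnergy a x = p * ∑ T : SiteSet p N, spinProd x T.1 * a T := by
  unfold setEnergy setField
  simp_rw [Finset.mul_sum]
  rw [Finset.sum_comm]
  refine Finset.sum_congr rfl fun T _ => ?_
  calc _ = ∑ i, if i ∈ T.1 then spinProd x T.1 * a T else 0 := by
        refine Finset.sum_congr rfl fun i _ => ?_
        split_ifs with h
        · rw [← mul_assoc, spin_mul_spinProd_erase x h]
        · simp
    _ = _ := by
        rw [← Finset.sum_filter, Finset.sum_const, Finset.filter_mem_eq_inter,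
          Finset.univ_inter, T.2, nsmul_eq_mul]

lemma setEnergy_flip (a : SiteSet p N → ℝ) (x : Config N) (i : Fin N) :
    setEnergy a (flip i x) = setEnergy a x - 2 * p * (spin x i * setField a x i) := by
  rw [setEnergy_eq, setEnergy_eq, setField, mul_comm 2 (p : ℝ), mul_assoc (p : ℝ),
    ← mul_sub]
  congr 1
  rw [Finset.mul_sum, Finset.mul_sum, ← Finset.sum_sub_distrib]
  refine Finset.sum_congr rfl fun T _ => ?_
  split_ifs with h
  · rw [spinProd_flip_of_mem h, ← spin_mul_spinProd_erase x h]
    ring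
  · rw [spinProd_flip_of_notMem h]
    ring

end Flip

/-! ### Change of the score under a flip -/

section Score

variable {p N : ℕ}

/-- The residual of site `i` in the pseudo-likelihood equation with parameter `θ = p b`. -/
noncomputable def residual (a : SiteSet p N → ℝ) (θ : ℝ) (x : Config N) (i : Fin N) : ℝ :=
  setField a x i * (spin x i - Real.tanh (θ * setField a x i))

/-- The derivative of the log-pseudo-likelihood, up to the factor `p`. -/
noncomputable def score (a : SiteSet p N → ℝ) (θ : ℝ) (x : Config N) : ℝ :=
  ∑ i, residual a θ x i

lemma abs_residual_le (a : SiteSet p N → ℝ) (θ : ℝ) (x : Config N) (i : Fin N) :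
    |residual a θ x i| ≤ 2 * |setField a x i| := by
  rw [residual, abs_mul, mul_comm]
  gcongr
  calc _ ≤ |spin x i| + |Real.tanh (θ * setField a x i)| := abs_sub _ _
    _ ≤ 2 := by rw [abs_spin]; linarith [Real.abs_tanh_lt_one (θ * setField a x i)]

lemma abs_mul_tanh_diff_le {θ : ℝ} (hθ : 0 < θ) (s m d : ℝ) :
    |m * (s - Real.tanh (θ * m)) - (m - d) * (s - Real.tanh (θ * (m - d)))
      - d * (s - mulTanhDeriv (θ * m))| ≤ 4 * θ * d ^ 2 := by
  have h := abs_mul_tanh_taylor_le (θ * m) (θ * d)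
  rw [← mul_sub] at h
  have e : θ * m * Real.tanh (θ * m) - θ * (m - d) * Real.tanh (θ * (m - d))
      - θ * d * mulTanhDeriv (θ * m)
      = -(θ * (m * (s - Real.tanh (θ * m)) - (m - d) * (s - Real.tanh (θ * (m - d)))
      - d * (s - mulTanhDeriv (θ * m)))) := by ring
  rw [e, abs_neg, abs_mul, abs_of_pos hθ] at h
  refine le_of_mul_le_mul_left (h.trans (le_of_eq (by ring))) hθ

/-- The site `i` contributes exactly `2 x_i m_i`, its own field being unchanged. At the other sites
the field moves by `2 x_i` times a Hessian entry, and a second-order Taylor bound applies. -/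
lemma score_flip_diff (a : SiteSet p N → ℝ) {θ : ℝ} (hθ : 0 < θ) (x : Config N) (i : Fin N) :
    |score a θ x - score a θ (flip i x) - 2 * spin x i * setField a x i
      - 2 * spin x i * ∑ j, setHess a x i j * (spin x j - mulTanhDeriv (θ * setField a x j))|
      ≤ 16 * θ * ∑ j, setHess a x i j ^ 2 := by
  have hterm : ∀ j, |residual a θ x j - residual a θ (flip i x) j
      - (if j = i then 2 * spin x i * setField a x i else 0)
      - 2 * spin x i * (setHess a x i j * (spin x j - mulTanhDeriv (θ * setField a x j)))|
      ≤ 16 * θ * setHess a x i j ^ 2 := by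
    intro j
    unfold residual
    by_cases hj : j = i
    · subst hj
      rw [if_pos rfl, setHess_self, setField_flip_self, spin_flip_self]
      ring_nf
      simp
    · rw [if_neg hj, spin_flip_of_ne hj, setField_flip]
      have := abs_mul_tanh_diff_le hθ (spin x j) (setField a x j)
        (2 * spin x i * setHess a x i j)
      calc _ = _ := by congr 1; ring
        _ ≤ _ := this
        _ = _ := by
          rw [mul_pow, mul_pow, sq (spin x i), spin_mul_self]
          ring
  have hsum : score a θ x - score a θ (flip i x) - 2 * spin x i * setField a x i
      - 2 * spin x i * ∑ j, setHess a x i j * (spin x j - mulTanhDeriv (θ * setField a x j))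
      = ∑ j, (residual a θ x j - residual a θ (flip i x) j
      - (if j = i then 2 * spin x i * setField a x i else 0)
      - 2 * spin x i * (setHess a x i j * (spin x j - mulTanhDeriv (θ * setField a x j)))) := by
    rw [Finset.sum_sub_distrib, Finset.sum_sub_distrib, Finset.sum_sub_distrib,
      Finset.sum_ite_eq' Finset.univ i, if_pos (Finset.mem_univ i), ← Finset.mul_sum]
    rfl
  rw [hsum, Finset.mul_sum]
  exact (Finset.abs_sum_le_sum_abs _ _).trans (Finset.sum_le_sum fun j _ => hterm j)

/-- A vector bounded by `c` is dominated by `c` times a sign vector in a bilinear form. -/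
lemma exists_config_bilinear_le (D : Fin N → Fin N → ℝ) (u v : Fin N → ℝ) {c : ℝ}
    (hv : ∀ j, |v j| ≤ c) :
    ∃ σ : Config N, ∑ i, u i * ∑ j, D i j * v j ≤ c * ∑ i, u i * ∑ j, D i j * spin σ j := by
  classical
  refine ⟨fun j => if 0 ≤ ∑ i, u i * D i j then 1 else -1, ?_⟩
  have hswap : ∀ w : Fin N → ℝ, ∑ i, u i * ∑ j, D i j * w j = ∑ j, w j * ∑ i, u i * D i j := by
    intro w
    simp_rw [Finset.mul_sum]
    rw [Finset.sum_comm]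
    exact Finset.sum_congr rfl fun j _ => Finset.sum_congr rfl fun i _ => by ring
  rw [hswap, hswap, Finset.mul_sum]
  refine Finset.sum_le_sum fun j _ => ?_
  set y := ∑ i, u i * D i j with hy
  have h1 : v j * y ≤ c * |y| := by
    calc v j * y ≤ |v j * y| := le_abs_self _
      _ = |v j| * |y| := abs_mul _ _
      _ ≤ c * |y| := by gcongr; exact hv j
  refine h1.trans (le_of_eq ?_)
  congr 1
  simp only [spin, ← hy]
  split_ifs with h
  · rw [abs_of_nonneg h]; simp
  · rw [abs_of_neg (not_le.mp h)]; simp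

/-- The constant `19 K` is `4 K` from the flipped site plus `15 K` from the bilinear term; the rest
is the Taylor remainder. -/
lemma sum_residual_mul_diff_le {a : SiteSet p N → ℝ} {K ε θ : ℝ} (h : RegularCouplings a K ε)
    (hK : 0 ≤ K) (hθ : 0 < θ) (x : Config N) :
    ∑ i, residual a θ x i * (score a θ x - score a θ (flip i x))
      ≤ (19 * K + 32 * θ * K * (1 + K)) * N := by
  set m := setField a x with hm
  set u := residual a θ x with hu
  have hu2 : ∀ i, |u i| ≤ 2 * |m i| := abs_residual_le a θ x
  set v : Fin N → ℝ := fun j => spin x j - mulTanhDeriv (θ * m j) with hv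
  have hv3 : ∀ j, |v j| ≤ 3 := fun j =>
    (abs_sub _ _).trans (by rw [abs_spin]; linarith [abs_mulTanhDeriv_le (θ * m j)])
  set u' : Fin N → ℝ := fun i => u i * spin x i with hu'
  have husq : ∀ i, u' i ^ 2 ≤ 4 * m i ^ 2 := by
    intro i
    have h1 : u' i ^ 2 = |u i| ^ 2 := by
      rw [hu', mul_pow, sq (spin x i), spin_mul_self, mul_one, sq_abs]
    rw [h1, ← sq_abs (m i)]
    calc |u i| ^ 2 ≤ (2 * |m i|) ^ 2 := pow_le_pow_left₀ (abs_nonneg _) (hu2 i) 2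
      _ = _ := by ring
  have hm2 : ∑ i, m i ^ 2 ≤ K * N := h.field_le x
  -- The vector `v` depends on the disorder; replacing it by a sign vector is what lets a union over
  -- configurations suffice.
  obtain ⟨σ, hσ⟩ := exists_config_bilinear_le (setHess a x) u' v hv3
  have hterm : ∀ i, u i * (score a θ x - score a θ (flip i x))
      ≤ 4 * m i ^ 2 + 2 * (u' i * ∑ j, setHess a x i j * v j)
        + 32 * θ * K * (1 + m i ^ 2) := by
    intro i
    set R := score a θ x - score a θ (flip i x) - 2 * spin x i * m i
      - 2 * spin x i * ∑ j, setHess a x i j * v j with hR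
    have hRle : |R| ≤ 16 * θ * K := (score_flip_diff a hθ x i).trans (by
      gcongr
      exact h.hess_row x i)
    have e : u i * (score a θ x - score a θ (flip i x))
        = 2 * (u' i * m i) + 2 * (u' i * ∑ j, setHess a x i j * v j) + u i * R := by
      rw [hR, hu']; ring
    have b1 : 2 * (u' i * m i) ≤ 4 * m i ^ 2 := by
      have : |u' i| ≤ 2 * |m i| := by
        rw [hu', abs_mul, abs_spin, mul_one]; exact hu2 i
      calc 2 * (u' i * m i) ≤ 2 * |u' i * m i| := by gcongr; exact le_abs_self _
        _ = 2 * (|u' i| * |m i|) := by rw [abs_mul]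
        _ ≤ 2 * (2 * |m i| * |m i|) := by gcongr
        _ = 4 * m i ^ 2 := by rw [← sq_abs (m i)]; ring
    have b3 : u i * R ≤ 32 * θ * K * (1 + m i ^ 2) := by
      have hle : |m i| ≤ 1 + m i ^ 2 := by
        nlinarith [sq_abs (m i), sq_nonneg (|m i| - 1), abs_nonneg (m i)]
      calc u i * R ≤ |u i * R| := le_abs_self _
        _ = |u i| * |R| := abs_mul _ _
        _ ≤ 2 * (1 + m i ^ 2) * (16 * θ * K) := by
            gcongr
            exact (hu2 i).trans (by gcongr)
        _ = _ := by ring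
    linarith
  have hbil : ∑ i, u' i * ∑ j, setHess a x i j * spin σ j ≤ 5 / 2 * (K * N) := by
    calc ∑ i, u' i * ∑ j, setHess a x i j * spin σ j
        ≤ ∑ i, (1 / 2) * (4 * m i ^ 2 + (∑ j, setHess a x i j * spin σ j) ^ 2) := by
          refine Finset.sum_le_sum fun i _ => ?_
          nlinarith [husq i, sq_nonneg (u' i - ∑ j, setHess a x i j * spin σ j)]
      _ = 2 * ∑ i, m i ^ 2 + 1 / 2 * ∑ i, (∑ j, setHess a x i j * spin σ j) ^ 2 := by
          rw [← Finset.mul_sum, Finset.sum_add_distrib, ← Finset.mul_sum]; ring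
      _ ≤ _ := by linarith [h.hess_bilinear x σ]
  calc ∑ i, u i * (score a θ x - score a θ (flip i x))
      ≤ ∑ i, (4 * m i ^ 2 + 2 * (u' i * ∑ j, setHess a x i j * v j)
        + 32 * θ * K * (1 + m i ^ 2)) := Finset.sum_le_sum fun i _ => hterm i
    _ = 4 * ∑ i, m i ^ 2 + 2 * ∑ i, u' i * ∑ j, setHess a x i j * v j
        + 32 * θ * K * (N + ∑ i, m i ^ 2) := by
        rw [Finset.sum_add_distrib, Finset.sum_add_distrib, ← Finset.mul_sum, ← Finset.mul_sum,
          ← Finset.mul_sum, Finset.sum_add_distrib]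
        simp
    _ ≤ 4 * (K * N) + 2 * (3 * (5 / 2 * (K * N))) + 32 * θ * K * (N + K * N) := by
        gcongr
        exact hσ.trans (by gcongr)
    _ = _ := by ring

end Score

/-! ### Second moment of the score under the Gibbs measure -/

section Moment

variable {p N : ℕ}

/-- Detailed balance for one spin: a spin with weight proportional to `exp (s u)` has mean `tanh u`.
-/
lemma exp_mul_add_tanh (s u : ℝ) (hs : s = 1 ∨ s = -1) :
    Real.exp (-(2 * (s * u))) * (s + Real.tanh u) = s - Real.tanh u := by
  have hpos : Real.exp u + Real.exp (-u) ≠ 0 := (add_pos (Real.exp_pos _) (Real.exp_pos _)).ne'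
  rw [Real.tanh_eq]
  rcases hs with rfl | rfl
  · rw [one_mul]
    have : Real.exp (-(2 * u)) * Real.exp u = Real.exp (-u) := by
      rw [← Real.exp_add]; ring_nf
    field_simp
    linear_combination 2 * this
  · rw [show -(2 * (-1 * u)) = 2 * u by ring]
    have : Real.exp (2 * u) * Real.exp (-u) = Real.exp u := by
      rw [← Real.exp_add]; ring_nf
    field_simp
    linear_combination (-2) * this

lemma partitionFunction_pos (J : Tensor p N) (β : ℝ) : 0 < partitionFunction J β := by
  unfold partitionFunction
  have : 0 < ∑ x : Config N, Real.exp (β * hamiltonian J x) :=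
    Finset.sum_pos (fun x _ => Real.exp_pos _) Finset.univ_nonempty
  positivity

lemma isingMass_nonneg (J : Tensor p N) (β : ℝ) (x : Config N) : 0 ≤ isingMass J β x := by
  have := partitionFunction_pos J β
  unfold isingMass
  positivity

lemma sum_isingMass (J : Tensor p N) (β : ℝ) : ∑ x, isingMass J β x = 1 := by
  have hne := (partitionFunction_pos J β).ne'
  unfold isingMass
  rw [← Finset.mul_sum]
  have : ∑ x : Config N, Real.exp (β * hamiltonian J x) = 2 ^ N * partitionFunction J β := by
    unfold partitionFunction
    field_simp
  rw [this]
  field_simp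

variable {J : Tensor p N} {a : SiteSet p N → ℝ}

lemma isingMass_flip_mul_residual (hH : ∀ x, hamiltonian J x = setEnergy a x) (β : ℝ)
    (x : Config N) (i : Fin N) :
    isingMass J β (flip i x) * residual a (p * β) (flip i x) i
      = -(isingMass J β x * residual a (p * β) x i) := by
  unfold isingMass residual
  rw [hH, hH, setEnergy_flip, setField_flip_self, spin_flip_self]
  have hs : spin x i = 1 ∨ spin x i = -1 := by
    rcases Int.units_eq_one_or (x i) with h | h <;> simp [spin, h]
  have key := exp_mul_add_tanh (spin x i) (p * β * setField a x i) hs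
  have hexp : Real.exp (β * (setEnergy a x - 2 * p * (spin x i * setField a x i)))
      = Real.exp (β * setEnergy a x)
        * Real.exp (-(2 * (spin x i * (p * β * setField a x i)))) := by
    rw [← Real.exp_add]; ring_nf
  rw [hexp]
  linear_combination (-(1 / (2 ^ N * partitionFunction J β) * Real.exp (β * setEnergy a x)
    * setField a x i)) * key

/-- Mass times residual is odd under the flip at `i`, so reindexing by the flip antisymmetrizes `F`.
-/
lemma sum_isingMass_residual_mul (hH : ∀ x, hamiltonian J x = setEnergy a x) (β : ℝ)
    (F : Config N → ℝ) (i : Fin N) :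
    2 * ∑ x, isingMass J β x * (residual a (p * β) x i * F x)
      = ∑ x, isingMass J β x * (residual a (p * β) x i * (F x - F (flip i x))) := by
  have h : ∑ x, isingMass J β x * (residual a (p * β) x i * F x)
      = -∑ x, isingMass J β x * (residual a (p * β) x i * F (flip i x)) := by
    rw [← Equiv.sum_comp (flip_involutive i).toPerm, ← Finset.sum_neg_distrib]
    refine Finset.sum_congr rfl fun x _ => ?_
    simp only [Function.Involutive.coe_toPerm]
    rw [← mul_assoc, isingMass_flip_mul_residual hH]
    ring
  simp_rw [mul_sub, Finset.sum_sub_distrib]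
  linarith

lemma sum_isingMass_score_sq_le (hH : ∀ x, hamiltonian J x = setEnergy a x) {β C : ℝ}
    (hC : ∀ x, ∑ i, residual a (p * β) x i * (score a (p * β) x - score a (p * β) (flip i x))
      ≤ C) :
    ∑ x, isingMass J β x * score a (p * β) x ^ 2 ≤ C / 2 := by
  have h1 : 2 * ∑ x, isingMass J β x * score a (p * β) x ^ 2
      = ∑ x, isingMass J β x * ∑ i, residual a (p * β) x i *
        (score a (p * β) x - score a (p * β) (flip i x)) := by
    calc 2 * ∑ x, isingMass J β x * score a (p * β) x ^ 2
        = ∑ i, 2 * ∑ x, isingMass J β x * (residual a (p * β) x i * score a (p * β) x) := by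
          rw [← Finset.mul_sum, Finset.sum_comm]
          congr 1
          refine Finset.sum_congr rfl fun x _ => ?_
          rw [← Finset.mul_sum, ← Finset.sum_mul, sq]
          rfl
      _ = _ := by
          simp_rw [sum_isingMass_residual_mul hH, Finset.mul_sum]
          rw [Finset.sum_comm]
  have h2 : ∑ x, isingMass J β x * ∑ i, residual a (p * β) x i *
        (score a (p * β) x - score a (p * β) (flip i x)) ≤ ∑ x, isingMass J β x * C :=
    Finset.sum_le_sum fun x _ => mul_le_mul_of_nonneg_left (hC x) (isingMass_nonneg J β x)
  rw [← Finset.sum_mul, sum_isingMass, one_mul] at h2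
  linarith

/-- Chebyshev's inequality for the Gibbs measure. -/
lemma one_sub_lt_isingProb {β δ R : ℝ} {F : Config N → ℝ} {A : Set (Config N)} (hR : 0 < R)
    (hF : ∑ x, isingMass J β x * F x ^ 2 < δ * R) (hA : ∀ x, F x ^ 2 ≤ R → x ∈ A) :
    1 - δ < isingProb J β A := by
  classical
  have h1 := Finset.sum_filter_add_sum_filter_not Finset.univ (fun x => x ∈ A) (isingMass J β)
  rw [sum_isingMass] at h1
  have h2 : (∑ x with x ∉ A, isingMass J β x) * R ≤ ∑ x, isingMass J β x * F x ^ 2 := by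
    rw [Finset.sum_mul]
    calc _ ≤ ∑ x with x ∉ A, isingMass J β x * F x ^ 2 := by
          refine Finset.sum_le_sum fun x hx => ?_
          have hx' : x ∉ A := (Finset.mem_filter.mp hx).2
          have : R ≤ F x ^ 2 := by
            by_contra hlt
            exact hx' (hA x (not_le.mp hlt).le)
          exact mul_le_mul_of_nonneg_left this (isingMass_nonneg J β x)
      _ ≤ _ := Finset.sum_le_sum_of_subset_of_nonneg (Finset.filter_subset _ _)
          fun x _ _ => mul_nonneg (isingMass_nonneg J β x) (sq_nonneg _)
  have h3 : ∑ x with x ∉ A, isingMass J β x < δ :=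
    lt_of_mul_lt_mul_right (h2.trans_lt hF) hR.le
  have h4 : isingProb J β A = ∑ x with x ∈ A, isingMass J β x := by
    unfold isingProb
    congr!
  rw [h4]
  linarith

end Moment

/-! ### Slope of the score and localization of its zero -/

section Curvature

variable {p N : ℕ} {a : SiteSet p N → ℝ} {K ε : ℝ}

/-- The curvature constant of the log-pseudo-likelihood for parameters `θ ≤ B`. -/
noncomputable def curvature (K ε B : ℝ) : ℝ := ε * (1 - Real.tanh (B * √(2 * K)) ^ 2)

lemma curvature_pos (hε : 0 < ε) (B : ℝ) : 0 < curvature K ε B :=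
  mul_pos hε (one_sub_tanh_sq_pos _)

/-- Large fields saturate `tanh` and yield no uniform slope. By Markov at least half of the sites
have squared field at most `2 K`, and `field_ge` holds on every such set; the other sites are
monotone and can be dropped. -/
lemma score_sub_ge (h : RegularCouplings a K ε) (hK : 0 < K) (x : Config N) {B b b' : ℝ}
    (hb : 0 ≤ b) (hbb : b ≤ b') (hB : b' ≤ B) :
    curvature K ε B * N * (b' - b) ≤ score a b x - score a b' x := by
  classical
  set m := setField a x with hm
  set I : Finset (Fin N) := Finset.univ.filter fun i => m i ^ 2 ≤ 2 * K with hI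
  have hcard : N ≤ 2 * I.card := by
    have h1 : I.card + Iᶜ.card = N := by rw [Finset.card_add_card_compl, Fintype.card_fin]
    have h2 : (Iᶜ.card : ℝ) * (2 * K) ≤ K * N := by
      calc (Iᶜ.card : ℝ) * (2 * K) = ∑ _i ∈ Iᶜ, 2 * K := by rw [Finset.sum_const, nsmul_eq_mul]
        _ ≤ ∑ i ∈ Iᶜ, m i ^ 2 := by
            refine Finset.sum_le_sum fun i hi => ?_
            simp only [hI, Finset.mem_compl, Finset.mem_filter, Finset.mem_univ, true_and,
              not_le] at hi
            exact hi.le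
        _ ≤ ∑ i, m i ^ 2 := Finset.sum_le_sum_of_subset_of_nonneg (Finset.subset_univ _)
            fun i _ _ => sq_nonneg _
        _ ≤ K * N := h.field_le x
    have h3 : (2 * Iᶜ.card : ℝ) ≤ N := by nlinarith
    have h4 : 2 * Iᶜ.card ≤ N := by exact_mod_cast h3
    omega
  have hκ := one_sub_tanh_sq_pos (B * √(2 * K))
  have hdiff : score a b x - score a b' x
      = ∑ i, (m i * Real.tanh (b' * m i) - m i * Real.tanh (b * m i)) := by
    unfold score residual
    rw [← Finset.sum_sub_distrib]
    exact Finset.sum_congr rfl fun i _ => by rw [← hm]; ring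
  rw [hdiff]
  calc curvature K ε B * N * (b' - b)
      = (1 - Real.tanh (B * √(2 * K)) ^ 2) * (ε * N) * (b' - b) := by unfold curvature; ring
    _ ≤ (1 - Real.tanh (B * √(2 * K)) ^ 2) * (∑ i ∈ I, m i ^ 2) * (b' - b) := by
        have := h.field_ge x I hcard
        have hbb' := sub_nonneg.mpr hbb
        gcongr
    _ = ∑ i ∈ I, (1 - Real.tanh (B * √(2 * K)) ^ 2) * m i ^ 2 * (b' - b) := by
        rw [Finset.mul_sum, Finset.sum_mul]
    _ ≤ ∑ i ∈ I, (m i * Real.tanh (b' * m i) - m i * Real.tanh (b * m i)) := by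
        refine Finset.sum_le_sum fun i hi => le_mul_tanh_sub ?_ hb hbb hB
        exact Real.abs_le_sqrt (Finset.mem_filter.mp hi).2
    _ ≤ _ := Finset.sum_le_sum_of_subset_of_nonneg (Finset.subset_univ _)
        fun i _ _ => sub_nonneg.mpr (mul_tanh_mul_mono (m i) hbb)

lemma continuous_score (x : Config N) : Continuous fun θ => score a θ x := by
  unfold score residual
  refine continuous_finsetSum _ fun i _ => continuous_const.mul (continuous_const.sub ?_)
  exact continuous_tanh.comp (continuous_id.mul continuous_const)

/-- Strict monotonicity on the half line makes the solution set a singleton, so the infimum is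
attained there. -/
lemma mple_eq_of_score_eq_zero {J : Tensor p N} (hp : 1 ≤ p) (hN : 1 ≤ N)
    (hH : ∀ x, hamiltonian J x = setEnergy a x) (hm : ∀ x i, localField J x i = setField a x i)
    (h : RegularCouplings a K ε) (hK : 0 < K) (hε : 0 < ε) (x : Config N) {b : ℝ} (hb : 0 ≤ b)
    (hzero : score a (p * b) x = 0) : mple J x = (b : EReal) := by
  have hp' : (0 : ℝ) < p := by exact_mod_cast hp
  have hN' : (0 : ℝ) < N := by exact_mod_cast hN
  have hset : {b : ℝ | 0 ≤ b ∧ hamiltonian J x =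
      ∑ i : Fin N, localField J x i * Real.tanh ((p : ℝ) * b * localField J x i)} = {b} := by
    have hscore : ∀ c : ℝ, (hamiltonian J x =
        ∑ i : Fin N, localField J x i * Real.tanh ((p : ℝ) * c * localField J x i))
        ↔ score a (p * c) x = 0 := by
      intro c
      simp_rw [hH, hm]
      rw [← sub_eq_zero]
      unfold score residual setEnergy
      rw [← Finset.sum_sub_distrib]
      refine Eq.congr (Finset.sum_congr rfl fun i _ => by ring) rfl
    have hlt : ∀ c d : ℝ, 0 ≤ c → c < d → score a (p * d) x < score a (p * c) x := by
      intro c d hc hcd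
      have hmul : p * c < p * d := mul_lt_mul_of_pos_left hcd hp'
      have h1 := score_sub_ge h hK x (mul_nonneg hp'.le hc) hmul.le (le_refl (p * d))
      have h2 := mul_pos (mul_pos (curvature_pos (K := K) hε (p * d)) hN') (sub_pos.mpr hmul)
      linarith
    ext c
    simp only [Set.mem_ofPred_eq, Set.mem_singleton_iff, hscore]
    constructor
    · rintro ⟨hc, hc0⟩
      rcases lt_trichotomy c b with hlt' | heq | hlt'
      · have := hlt c b hc hlt'
        linarith
      · exact heq
      · have := hlt b c hb hlt'
        linarith
    · rintro rfl
      exact ⟨hb, hzero⟩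
  rw [mple, hset, Set.image_singleton, sInf_singleton]

/-- A small score at `β` forces the estimate to be close to `β`. -/
lemma mem_mpleWithin {J : Tensor p N} (hp : 1 ≤ p) (hN : 1 ≤ N)
    (hH : ∀ x, hamiltonian J x = setEnergy a x) (hm : ∀ x i, localField J x i = setField a x i)
    (h : RegularCouplings a K ε) (hK : 0 < K) (hε : 0 < ε) {β M : ℝ} (hM : 0 ≤ M)
    (hMN : M / √N ≤ β) (x : Config N)
    (hx : |score a (p * β) x| ≤ curvature K ε (p * (2 * β)) * p * M * √N) :
    x ∈ mpleWithin J β M := by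
  have hp' : (0 : ℝ) < p := by exact_mod_cast hp
  have hN' : (0 : ℝ) < N := by exact_mod_cast hN
  have hs : 0 < √(N : ℝ) := Real.sqrt_pos.mpr hN'
  set r := M / √(N : ℝ) with hr
  have hr0 : 0 ≤ r := by positivity
  set c := curvature K ε (p * (2 * β)) with hc
  have hcr : c * N * (p * r) = c * p * M * √N := by
    rw [hr]
    have : (N : ℝ) = √N * √N := (Real.mul_self_sqrt hN'.le).symm
    nth_rewrite 1 [this]
    field_simp
  rw [abs_le] at hx
  -- Moving `r` away from `β` changes the score by at least `c p M √N`, enough to fix its sign on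
  -- each side; `r ≤ β` keeps the interval inside `[0, 2 β]`.
  have h1 : 0 ≤ score a (p * (β - r)) x := by
    have := score_sub_ge h hK x (B := p * (2 * β)) (b := p * (β - r)) (b' := p * β)
      (mul_nonneg hp'.le (by linarith)) (by gcongr; linarith) (by gcongr; linarith)
    rw [← hc, show p * β - p * (β - r) = p * r by ring, hcr] at this
    linarith
  have h2 : score a (p * (β + r)) x ≤ 0 := by
    have := score_sub_ge h hK x (B := p * (2 * β)) (b := p * β) (b' := p * (β + r))
      (mul_nonneg hp'.le (by linarith)) (by gcongr; linarith) (by gcongr; linarith)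
    rw [← hc, show p * (β + r) - p * β = p * r by ring, hcr] at this
    linarith
  have hcont : ContinuousOn (fun b => score a (p * b) x) (Set.Icc (β - r) (β + r)) :=
    ((continuous_score x).comp (continuous_const.mul continuous_id)).continuousOn
  obtain ⟨b, hb, hb0⟩ := intermediate_value_Icc' (by linarith) hcont ⟨h2, h1⟩
  refine ⟨b, mple_eq_of_score_eq_zero hp hN hH hm h hK hε x (by linarith [hb.1]) hb0, ?_⟩
  have : |b - β| ≤ r := abs_le.mpr ⟨by linarith [hb.1], by linarith [hb.2]⟩
  calc √(N : ℝ) * |b - β| ≤ √N * r := by gcongr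
    _ = M := by rw [hr]; field_simp

/-- The constant in the second moment bound of the score. -/
noncomputable def momentConst (K θ : ℝ) : ℝ := 19 * K + 32 * θ * K * (1 + K)

lemma momentConst_pos (hK : 0 < K) {θ : ℝ} (hθ : 0 < θ) : 0 < momentConst K θ := by
  unfold momentConst
  positivity

/-- The radius of the confidence interval, in units of `1 / √N`. -/
noncomputable def mpleRadius (p : ℕ) (K ε δ β : ℝ) : ℝ :=
  √(momentConst K (p * β) / δ) / (curvature K ε (p * (2 * β)) * p)

lemma mpleRadius_pos (hp : 1 ≤ p) (hK : 0 < K) (hε : 0 < ε) {δ β : ℝ} (hδ : 0 < δ)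
    (hβ : 0 < β) : 0 < mpleRadius p K ε δ β := by
  have hp' : (0 : ℝ) < p := by exact_mod_cast hp
  have h1 := curvature_pos (K := K) hε (p * (2 * β))
  have h2 := momentConst_pos hK (mul_pos hp' hβ)
  unfold mpleRadius
  positivity

theorem one_sub_lt_isingProb_mpleWithin {J : Tensor p N} (hp : 1 ≤ p) (hN : 1 ≤ N)
    (hH : ∀ x, hamiltonian J x = setEnergy a x) (hm : ∀ x i, localField J x i = setField a x i)
    (h : RegularCouplings a K ε) (hK : 0 < K) (hε : 0 < ε) {β δ : ℝ} (hβ : 0 < β) (hδ : 0 < δ)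
    (hMN : mpleRadius p K ε δ β / √N ≤ β) :
    1 - δ < isingProb J β (mpleWithin J β (mpleRadius p K ε δ β)) := by
  have hp' : (0 : ℝ) < p := by exact_mod_cast hp
  have hN' : (0 : ℝ) < N := by exact_mod_cast hN
  have hC := momentConst_pos hK (mul_pos hp' hβ)
  have hc := curvature_pos (K := K) hε (p * (2 * β))
  set C := momentConst K (p * β) with hCdef
  have h2 := sum_isingMass_score_sq_le hH (β := β)
    (sum_residual_mul_diff_le h hK.le (mul_pos hp' hβ))
  -- Here `δ * R = C N`, twice the moment bound, which gives the strict inequality; `mpleRadius`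
  -- makes its score threshold equal to `√R`.
  refine one_sub_lt_isingProb (F := score a (p * β)) (R := C / δ * N) (by positivity) ?_ ?_
  · refine h2.trans_lt ?_
    have e : δ * (C / δ * N) = C * N := by field_simp
    rw [e]
    change C * N / 2 < C * N
    linarith [mul_pos hC hN']
  · intro x hx
    refine mem_mpleWithin hp hN hH hm h hK hε (mpleRadius_pos hp hK hε hδ hβ).le hMN x ?_
    have e : curvature K ε (p * (2 * β)) * p * mpleRadius p K ε δ β = √(C / δ) := by
      rw [mpleRadius, ← hCdef]
      exact mul_div_cancel₀ _ (mul_pos hc hp').ne'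
    rw [e, ← Real.sqrt_mul (by positivity)]
    exact Real.abs_le_sqrt hx

end Curvature

/-! ### From tensors on tuples to couplings on site sets -/

section Tuples

variable {p N : ℕ}

lemma hamiltonian_eq_sum_localField (hp : 1 ≤ p) (J : Tensor p N) (x : Config N) :
    hamiltonian J x = ∑ i, spin x i * localField J x i := by
  classical
  let s₀ : Fin p := ⟨0, hp⟩
  have hs : ∀ s : Fin p, (s : ℕ) = 0 ↔ s = s₀ := fun s => by simp [s₀, Fin.ext_iff]
  unfold hamiltonian localField
  simp only [hs, forall_eq, ne_eq, Finset.mul_sum]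
  rw [← Finset.sum_fiberwise Finset.univ (fun k : Fin p → Fin N => k s₀)]
  refine Finset.sum_congr rfl fun i _ => Finset.sum_congr rfl fun k hk => ?_
  have hk' : k s₀ = i := (Finset.mem_filter.mp hk).2
  have : ∏ s, spin x (k s) = spin x i * ∏ s with ¬ s = s₀, spin x (k s) := by
    rw [Finset.filter_ne', ← hk', Finset.mul_prod_erase _ (fun s => spin x (k s)) (Finset.mem_univ s₀)]
  rw [this]
  ring

lemma injective_of_image_eq (T : SiteSet p N) {k : Fin p → Fin N}
    (hk : Finset.univ.image k = T.1) : Function.Injective k := by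
  rw [← Set.injOn_univ, ← Finset.coe_univ, ← Finset.card_image_iff, hk, T.2, Finset.card_univ,
    Fintype.card_fin]

lemma card_image_eq (T : SiteSet p N) :
    (Finset.univ.filter fun k : Fin p → Fin N => Finset.univ.image k = T.1).card
      = p.factorial := by
  have hc : Fintype.card (Fin p) = Fintype.card T.1 := by simp [T.2]
  have h := Fintype.card_equiv (Fintype.equivOfCardEq hc)
  rw [Fintype.card_fin] at h
  rw [← h, ← Finset.card_univ]
  symm
  refine Finset.card_bij (fun e _ s => (e s).1) ?_ ?_ ?_
  · intro e _
    simp only [Finset.mem_filter, Finset.mem_univ, true_and]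
    ext j
    simp only [Finset.mem_image, Finset.mem_univ, true_and]
    constructor
    · rintro ⟨s, rfl⟩
      exact (e s).2
    · intro hj
      exact ⟨e.symm ⟨j, hj⟩, by simp⟩
  · intro e _ e' _ hee
    ext s
    exact congrArg Fin.val (congrFun hee s)
  · intro k hk
    have hk' : Finset.univ.image k = T.1 := (Finset.mem_filter.mp hk).2
    have hinj := injective_of_image_eq T hk'
    have hmem : ∀ s, k s ∈ T.1 := fun s => hk' ▸ Finset.mem_image_of_mem k (Finset.mem_univ s)
    have hbij : Function.Bijective fun s => (⟨k s, hmem s⟩ : T.1) :=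
      (Fintype.bijective_iff_injective_and_card _).mpr
        ⟨fun s s' h => hinj (congrArg Subtype.val h), hc⟩
    exact ⟨Equiv.ofBijective _ hbij, Finset.mem_univ _, rfl⟩

/-- Composing with the transposition of `i` and `j` preserves `T`. Used both ways, it shows that the
`p !` enumerations of `T` split evenly by their value at `s`. -/
lemma card_image_eq_and_apply_le (T : SiteSet p N) (s : Fin p) {i j : Fin N} (hi : i ∈ T.1)
    (hj : j ∈ T.1) :
    (Finset.univ.filter fun k : Fin p → Fin N => Finset.univ.image k = T.1 ∧ k s = i).card
      ≤ (Finset.univ.filter fun k : Fin p → Fin N => Finset.univ.image k = T.1 ∧ k s = j).card := by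
  refine Finset.card_le_card_of_injOn (fun k => Equiv.swap i j ∘ k) ?_ ?_
  · intro k hk
    simp only [Finset.coe_filter, Finset.mem_univ, true_and, Set.mem_ofPred_eq] at hk ⊢
    refine ⟨?_, by simp [hk.2]⟩
    rw [← Finset.image_image, hk.1]
    refine Finset.eq_of_subset_of_card_le (fun l hl => ?_)
      (Finset.card_image_of_injective _ (Equiv.injective _)).ge
    obtain ⟨m, hm, rfl⟩ := Finset.mem_image.mp hl
    rw [Equiv.swap_apply_def]
    split_ifs
    · exact hj
    · exact hi
    · exact hm
  · intro k _ k' _ h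
    exact (Equiv.injective (Equiv.swap i j)).comp_left h

lemma card_image_eq_and_apply (hp : 1 ≤ p) (T : SiteSet p N) (s : Fin p) {i : Fin N}
    (hi : i ∈ T.1) :
    (Finset.univ.filter fun k : Fin p → Fin N => Finset.univ.image k = T.1 ∧ k s = i).card
      = (p - 1).factorial := by
  have hmaps : ∀ k ∈ Finset.univ.filter (fun k : Fin p → Fin N => Finset.univ.image k = T.1),
      k s ∈ T.1 := fun k hk => by
    rw [← (Finset.mem_filter.mp hk).2]
    exact Finset.mem_image_of_mem k (Finset.mem_univ s)
  have h := Finset.card_eq_sum_card_fiberwise hmaps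
  simp only [Finset.filter_filter] at h
  rw [card_image_eq, Finset.sum_congr rfl fun j hj => le_antisymm
    (card_image_eq_and_apply_le T s hj hi) (card_image_eq_and_apply_le T s hi hj),
    Finset.sum_const, T.2, smul_eq_mul, ← Nat.mul_factorial_pred (by omega)] at h
  exact (Nat.eq_of_mul_eq_mul_left (by omega) h).symm

lemma prod_spin_eq_spinProd (T : SiteSet p N) {k : Fin p → Fin N}
    (hk : Finset.univ.image k = T.1) (x : Config N) (s₀ : Fin p) :
    ∏ s with s ≠ s₀, spin x (k s) = spinProd x (T.1.erase (k s₀)) := by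
  have hinj := injective_of_image_eq T hk
  rw [spinProd, ← hk, ← Finset.image_erase hinj, Finset.prod_image hinj.injOn, Finset.filter_ne']

/-- Each `T` containing `i` arises from `(p - 1)!` tuples starting at `i`, which is the factorial in
`skScale`; tuples with repeated entries carry zero coupling. -/
theorem localField_skTensor (hp : 1 ≤ p) (g : CouplingIndex p → ℝ) (x : Config N) (i : Fin N) :
    localField (skTensor g N) x i = setField (skCoupling g N) x i := by
  classical
  let s₀ : Fin p := ⟨0, hp⟩
  have hs : ∀ s : Fin p, (s : ℕ) = 0 ↔ s = s₀ := fun s => by simp [s₀, Fin.ext_iff]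
  have hterm : ∀ k : Fin p → Fin N, k s₀ = i →
      skTensor g N k * ∏ s with s ≠ s₀, spin x (k s)
        = ∑ T : SiteSet p N, if Finset.univ.image k = T.1 then
          (N : ℝ) ^ ((1 - (p : ℝ)) / 2) * g (siteIndex T) * spinProd x (T.1.erase i) else 0 := by
    intro k hki
    by_cases hk : Function.Injective k
    · set T₀ : SiteSet p N := ⟨Finset.univ.image k,
        (Finset.card_image_of_injective _ hk).trans (Finset.card_fin p)⟩ with hT₀
      have hidx : tupleIndex k hk = siteIndex T₀ := by
        apply Subtype.ext
        simp only [tupleIndex, siteIndex, hT₀, Finset.image_image]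
        rfl
      rw [Finset.sum_eq_single T₀]
      · rw [if_pos rfl, skTensor, dif_pos hk, hidx, prod_spin_eq_spinProd T₀ rfl, hki]
      · intro T _ hT
        exact if_neg fun h => hT (Subtype.ext h.symm)
      · exact fun h => absurd (Finset.mem_univ _) h
    · rw [skTensor, dif_neg hk, zero_mul]
      exact (Finset.sum_eq_zero fun T _ => if_neg fun h => hk (injective_of_image_eq T h)).symm
  unfold localField setField
  simp only [hs, forall_eq, ne_eq]
  rw [Finset.sum_congr rfl fun k hk => hterm k (Finset.mem_filter.mp hk).2, Finset.sum_comm]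
  refine Finset.sum_congr rfl fun T _ => ?_
  rw [← Finset.sum_filter, Finset.filter_filter, Finset.sum_const, nsmul_eq_mul]
  simp_rw [and_comm (a := _ = i)]
  split_ifs with hi
  · rw [card_image_eq_and_apply hp T s₀ hi, skCoupling, skScale]
    ring
  · rw [Finset.filter_false_of_mem, Finset.card_empty]
    · simp
    · rintro k _ ⟨hk, hki⟩
      exact hi (hk ▸ hki ▸ Finset.mem_image_of_mem k (Finset.mem_univ s₀))

theorem hamiltonian_skTensor (hp : 1 ≤ p) (g : CouplingIndex p → ℝ) (x : Config N) :
    hamiltonian (skTensor g N) x = setEnergy (skCoupling g N) x := by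
  rw [hamiltonian_eq_sum_localField hp]
  simp_rw [localField_skTensor hp]
  rfl

end Tuples
end TensorIsing

/-! ### Consistency of the estimate -/

theorem mainTheorem2 {Ω : Type*} [MeasurableSpace Ω] (μ : Measure Ω) [IsProbabilityMeasure μ]
    (p : ℕ) (hp : 2 ≤ p) (g : TensorIsing.CouplingIndex p → Ω → ℝ)
    (hlaw : ∀ S, HasLaw (g S) (gaussianReal 0 1) μ)
    (hindep : iIndepFun g μ) :
    ∃ M : ℝ → ℝ → ℝ, (∀ δ β : ℝ, 0 < δ → 0 < β → 0 < M δ β) ∧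
      ∀ᵐ ω ∂μ, ∀ β : ℝ, 0 < β → ∀ δ : ℝ, 0 < δ →
        ∀ᶠ N : ℕ in atTop,
          1 - δ < TensorIsing.isingProb (TensorIsing.skTensor (fun S => g S ω) N) β
            (TensorIsing.mpleWithin (TensorIsing.skTensor (fun S => g S ω) N) β (M δ β)) := by
  have hp1 : 1 ≤ p := by omega
  have hK := TensorIsing.upperConst_pos hp1
  have hε := TensorIsing.lowerConst_pos (p := p)
  refine ⟨TensorIsing.mpleRadius p (TensorIsing.upperConst p) (TensorIsing.lowerConst p),
    fun δ β hδ hβ => TensorIsing.mpleRadius_pos hp1 hK hε hδ hβ, ?_⟩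
  -- The null set is fixed before `β` and `δ` are introduced, which gives the simultaneous
  -- statement.
  filter_upwards [TensorIsing.ae_eventually_regularCouplings μ hp g hlaw hindep]
    with ω hω β hβ δ hδ
  have hlim : Tendsto (fun N : ℕ => TensorIsing.mpleRadius p (TensorIsing.upperConst p)
      (TensorIsing.lowerConst p) δ β / √(N : ℝ)) atTop (nhds 0) :=
    (Real.tendsto_sqrt_atTop.comp tendsto_natCast_atTop_atTop).const_div_atTop _
  filter_upwards [hω, hlim.eventually_le_const hβ, eventually_ge_atTop 1] with N hN hMN hN1
  exact TensorIsing.one_sub_lt_isingProb_mpleWithin hp1 hN1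
    (TensorIsing.hamiltonian_skTensor hp1 _) (TensorIsing.localField_skTensor hp1 _)
    hN hK hε hβ hδ hMN
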